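/- Conventions. An operator algebra is a norm-closed, not necessarily selfadjoint, subalgebra of $B(H)$ for a complex Hilbert space $H$; $M_n(B(H))=B(H^n)$ gives its matrix norms. A cai is a contractive two-sided approximate identity, and an algebra with a cai is called approximately unital. Work in one of two categories: $\mathbf{OA}$, all operator algebras, or $\mathbf{AUOA}$, the approximately unital ones, with completely contractive homomorphisms as morphisms. A nontrivial subobject is a nonzero closed subalgebra which is an object of the category. An extension is an exact sequence $0\to\mathcal D\xrightarrow{\alpha}\mathcal E\xrightarrow{\beta}\mathcal F\to0$ of objects of the category and homomorphisms, with $\mathcal D,\mathcal F\ne0$, $\mathcal D$ approximately unital, $\alpha$ completely isometric, and $\beta$ a complete quotient map (for each $n$ it maps the open unit ball of $M_n(\mathcal E)$ onto that of $M_n(\mathcal F)$). A subextension consists of closed subalgebras $A\subset\mathcal D$, $B\subset\mathcal E$, $C\subset\mathcal F$ such that $\alpha$ and $\beta$ restrict to an extension $0\to A\to B\to C\to0$ in the same category. We write $bA+Ab\subset A$ for $b\,\alpha(A)+\alpha(A)\,b\subset\alpha(A)$. For an approximately unital operator algebra $A$, let $\mathcal M(A)$ be its multiplier algebra (pairs $(L,R)$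 of bounded linear maps on $A$ with $R(x)y=xL(y)$; a matrix in $M_n(\mathcal M(A))$ has the norm of left multiplication by it on $M_n(A)$), and $\mathcal Q(A)=\mathcal M(A)/A$ with the quotient matrix norms. The Busby invariant of an extension as above is the homomorphism $\tau:\mathcal F\to\mathcal Q(\mathcal D)$, $\tau(\beta(b))=\sigma(b)+\mathcal D$, where $\sigma(b)\in\mathcal M(\mathcal D)$ is the multiplier $\sigma(b)(d)=\alpha^{-1}(b\,\alpha(d))$ (acting on the right by $d\mapsto\alpha^{-1}(\alpha(d)\,b)$). Theorem. Let $0\to\mathcal D\xrightarrow{\alpha}\mathcal E\xrightarrow{\beta}\mathcal F\to0$ be an extension, in either category, and let $A$ be a closed subalgebra of $\mathcal D$ which contains a cai for $\mathcal D$. Put $$\mathcal G=\{\beta(b): b\in\mathcal E,\ bA+Ab\subset A\}.$$ 1. The map $(A,B,C)\mapsto C$ is a bijection from the set of subextensions with first term $A$ onto the set of nontrivial subobjects $C$ of $\mathcal F$ with $C\subset\mathcal G$. 2. For every such subextension the middle term is $$B=\{b\in\beta^{-1}(C): bA+Ab\subset A\}.$$ 3. Let $j:\mathcal Q(A)\to\mathcal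 Q(\mathcal D)$ be the canonical unital homomorphism, induced by the homomorphism $\mathcal M(A)\to\mathcal M(\mathcal D)$ which sends a multiplier of $A$ to the unique multiplier of $\mathcal D$ agreeing with it on $A$. Then $j$ is completely isometric and injective. If $\tau$ and $\tau'$ are the Busby invariants of the extension and of a subextension with terms $A,B,C$, then $j(\tau'(c))=\tau(c)$ for every $c\in C$; equivalently, $\tau'=j^{-1}\circ\tau|_C$, that is, $\tau'(c)$ is the only element which $j$ maps to $\tau(c)$. -/

import Mathlib

open Filter Topology MultiplierAlgebra

namespace OpAlg

/-! ### Matrix norms, complete isometries, complete quotient maps -/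

/-- A family of functions `‖·‖ₙ : Mₙ(V) → ℝ`, the data of an operator space structure. -/
class MatrixNorms (V : Type*) where
  /-- the norm of a square matrix with entries in `V` -/
  matNorm {n : ℕ} : Matrix (Fin n) (Fin n) V → ℝ


section Hilbert

variable {H : Type*} [NormedAddCommGroup H] [InnerProductSpace ℂ H]

/-- An `n × n` matrix of bounded operators on `H`, as a bounded operator on the Hilbert space
direct sum `Hⁿ`: `(X ξ) i = ∑ j, X i j (ξ j)`. -/
noncomputable def matrixOperator {n : ℕ} (X : Matrix (Fin n) (Fin n) (H →L[ℂ] H)) :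
    PiLp 2 (fun _ : Fin n => H) →L[ℂ] PiLp 2 (fun _ : Fin n => H) :=
  ((PiLp.continuousLinearEquiv 2 ℂ (fun _ : Fin n => H)).symm :
      (Fin n → H) →L[ℂ] PiLp 2 (fun _ : Fin n => H)) ∘L
    (ContinuousLinearMap.pi fun i => ∑ j, X i j ∘L ContinuousLinearMap.proj j) ∘L
    ((PiLp.continuousLinearEquiv 2 ℂ (fun _ : Fin n => H)) :
      PiLp 2 (fun _ : Fin n => H) →L[ℂ] (Fin n → H))

theorem matrixOperator_apply {n : ℕ} (X : Matrix (Fin n) (Fin n) (H →L[ℂ] H))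
    (ξ : PiLp 2 (fun _ : Fin n => H)) (i : Fin n) :
    matrixOperator X ξ i = ∑ j, X i j (ξ j) := by
  simp [matrixOperator]

/-- The matrix norms of `B(H)`: the norm of `Mₙ(B(H)) = B(Hⁿ)`. -/
noncomputable instance : MatrixNorms (H →L[ℂ] H) where
  matNorm := fun {n : ℕ} (X : Matrix (Fin n) (Fin n) (H →L[ℂ] H)) => ‖matrixOperator X‖

end Hilbert

/-- A subalgebra inherits the matrix norms. -/
instance {V : Type*} [NonUnitalNormedRing V] [NormedSpace ℂ V] [MatrixNorms V]
    (S : NonUnitalSubalgebra ℂ V) : MatrixNorms S where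
  matNorm X := MatrixNorms.matNorm (X.map (fun x : S => (x : V)))

/-- Compatibility of the matrix norms with the given norm at the level `n = 1`. -/
class LawfulMatrixNorms (V : Type*) [NonUnitalNormedRing V] [MatrixNorms V] : Prop where
  matNorm_one : ∀ x : V, MatrixNorms.matNorm (Matrix.of fun _ _ : Fin 1 => x) = ‖x‖

instance {H : Type*} [NormedAddCommGroup H] [InnerProductSpace ℂ H] :
    LawfulMatrixNorms (H →L[ℂ] H) where
  matNorm_one x := by
    change ‖matrixOperator (Matrix.of fun _ _ : Fin 1 => x)‖ = ‖x‖
    have key : ∀ ξ : PiLp 2 (fun _ : Fin 1 => H), ‖ξ‖ = ‖ξ 0‖ := fun ξ => by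
      simp [PiLp.norm_eq_of_L2]
    apply le_antisymm
    · refine ContinuousLinearMap.opNorm_le_bound _ (norm_nonneg _) fun ξ => ?_
      rw [key, key ξ, matrixOperator_apply]
      simpa using x.le_opNorm (ξ 0)
    · refine ContinuousLinearMap.opNorm_le_bound _ (ContinuousLinearMap.opNorm_nonneg _) fun v => ?_
      have := (matrixOperator (Matrix.of fun _ _ : Fin 1 => x)).le_opNorm
        (WithLp.toLp 2 (fun _ => v))
      rw [key, key (WithLp.toLp 2 (fun _ => v)), matrixOperator_apply] at this
      simpa using this

section Subalgebra

variable {V : Type*} [NonUnitalNormedRing V] [NormedSpace ℂ V]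

instance (S : NonUnitalSubalgebra ℂ V) : NormedSpace ℂ S where
  norm_smul_le c x := norm_smul_le c (x : V)

instance [IsScalarTower ℂ V V] (S : NonUnitalSubalgebra ℂ V) : IsScalarTower ℂ S S where
  smul_assoc c x y := Subtype.ext (smul_mul_assoc c (x : V) (y : V))

instance [SMulCommClass ℂ V V] (S : NonUnitalSubalgebra ℂ V) : SMulCommClass ℂ S S where
  smul_comm c x y := Subtype.ext (mul_smul_comm c (x : V) (y : V)).symm

instance [MatrixNorms V] [LawfulMatrixNorms V] (S : NonUnitalSubalgebra ℂ V) :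
    LawfulMatrixNorms S where
  matNorm_one x := LawfulMatrixNorms.matNorm_one (x : V)

end Subalgebra

/-- `f` preserves the norms of all matrices over `V`. -/
def IsCompleteIsometry {V W : Type*} [MatrixNorms V] [MatrixNorms W] (f : V → W) : Prop :=
  ∀ (n : ℕ) (X : Matrix (Fin n) (Fin n) V),
    MatrixNorms.matNorm (X.map f) = MatrixNorms.matNorm X

/-- `f` maps, at every matrix level, the open unit ball onto the open unit ball. -/
def IsCompleteQuotientMap {V W : Type*} [MatrixNorms V] [MatrixNorms W] (f : V → W) : Prop :=
  ∀ n : ℕ, (fun X : Matrix (Fin n) (Fin n) V => X.map f) '' {X | MatrixNorms.matNorm X < 1} =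
    {Y | MatrixNorms.matNorm Y < 1}

/-! ### Contractive approximate identities and the two categories -/

/-- `V` has a contractive two-sided approximate identity. -/
def ApproxUnital (V : Type*) [NonUnitalNormedRing V] : Prop :=
  ∃ l : Filter V, l.IsApproximateUnit ∧ ∀ᶠ e in l, ‖e‖ ≤ 1

/-- The subalgebra `A` of `V` contains a contractive two-sided approximate identity for `V`. -/
def ContainsCai {V : Type*} [NonUnitalNormedRing V] [NormedSpace ℂ V]
    (A : NonUnitalSubalgebra ℂ V) : Prop :=
  ∃ l : Filter A, (l.map (fun x : A => (x : V))).IsApproximateUnit ∧ ∀ᶠ e in l, ‖e‖ ≤ 1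

theorem ContainsCai.approxUnital {V : Type*} [NonUnitalNormedRing V] [NormedSpace ℂ V]
    {A : NonUnitalSubalgebra ℂ V} (h : ContainsCai A) : ApproxUnital A := by
  obtain ⟨l, hl, h1⟩ := h
  refine ⟨l, { tendsto_mul_left := fun m => ?_, tendsto_mul_right := fun m => ?_, neBot := ?_ }, h1⟩
  · exact tendsto_subtype_rng.2 (tendsto_map'_iff.1 (hl.tendsto_mul_left (m : V)))
  · exact tendsto_subtype_rng.2 (tendsto_map'_iff.1 (hl.tendsto_mul_right (m : V)))
  · exact map_neBot_iff _ |>.1 hl.neBot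

/-- The two categories of operator algebras: all operator algebras, and the approximately unital
ones. The morphisms are in both cases the completely contractive homomorphisms. -/
inductive OpAlgCategory
  | OA
  | AUOA

/-- The condition for an operator algebra to be an object of the category. -/
def OpAlgCategory.IsObject (𝒦 : OpAlgCategory) (V : Type*) [NonUnitalNormedRing V] : Prop :=
  match 𝒦 with
  | OA => True
  | AUOA => ApproxUnital V

/-- `C` is a nonzero subobject of `V`: a nonzero closed subalgebra which lies in the category. -/
structure IsNontrivialSubobject (𝒦 : OpAlgCategory) {V : Type*} [NonUnitalNormedRing V]
    [NormedSpace ℂ V] (C : NonUnitalSubalgebra ℂ V) : Prop where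
  isClosed : IsClosed (C : Set V)
  nontrivial : Nontrivial C
  isObject : 𝒦.IsObject C

/-! ### Multiplier algebra and corona algebra -/

theorem ApproxUnital.eq_of_mul_left {V : Type*} [NonUnitalNormedRing V] (hV : ApproxUnital V) {x y : V}
    (h : ∀ z, z * x = z * y) : x = y := by
  obtain ⟨l, hl, -⟩ := hV
  have := hl.neBot
  exact tendsto_nhds_unique (hl.tendsto_mul_right x)
    ((hl.tendsto_mul_right y).congr fun z => (h z).symm)

theorem ApproxUnital.eq_of_mul_right {V : Type*} [NonUnitalNormedRing V] (hV : ApproxUnital V) {x y : V}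
    (h : ∀ z, x * z = y * z) : x = y := by
  obtain ⟨l, hl, -⟩ := hV
  have := hl.neBot
  exact tendsto_nhds_unique (hl.tendsto_mul_left x)
    ((hl.tendsto_mul_left y).congr fun z => (h z).symm)

section Corona

variable (V : Type*) [NonUnitalNormedRing V] [NormedSpace ℂ V] [IsScalarTower ℂ V V]
  [SMulCommClass ℂ V V]

variable {V} in
theorem ApproxUnital.fst_mul (hV : ApproxUnital V) (T : 𝓜(ℂ, V)) (x y : V) :
    T.fst (x * y) = T.fst x * y :=
  hV.eq_of_mul_left fun z => by rw [← T.central, ← mul_assoc, ← mul_assoc, T.central]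

variable {V} in
theorem ApproxUnital.snd_mul (hV : ApproxUnital V) (T : 𝓜(ℂ, V)) (x y : V) :
    T.snd (x * y) = x * T.snd y :=
  hV.eq_of_mul_right fun z => by rw [T.central, mul_assoc, mul_assoc, T.central]

/-- `V` as a two-sided ideal of its multiplier algebra `𝓜(ℂ, V)`. -/
def coronaIdeal (hV : ApproxUnital V) : Ideal 𝓜(ℂ, V) where
  carrier := Set.range (DoubleCentralizer.coe ℂ)
  zero_mem' := ⟨0, by ext <;> simp⟩
  add_mem' := by
    rintro _ _ ⟨a, rfl⟩ ⟨b, rfl⟩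
    exact ⟨a + b, by ext <;> simp⟩
  smul_mem' := by
    rintro T _ ⟨a, rfl⟩
    refine ⟨T.fst a, ?_⟩
    ext x
    · simp [hV.fst_mul]
    · simp [T.central]

theorem mem_coronaIdeal (hV : ApproxUnital V) {T : 𝓜(ℂ, V)} :
    T ∈ coronaIdeal V hV ↔ ∃ a : V, DoubleCentralizer.coe ℂ a = T := Iff.rfl

instance (hV : ApproxUnital V) : (coronaIdeal V hV).IsTwoSided where
  mul_mem_of_left := by
    rintro _ T ⟨a, rfl⟩
    refine ⟨T.snd a, ?_⟩
    ext x
    · simp [T.central]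
    · simp [hV.snd_mul]

/-- The corona algebra `𝒬(V) = 𝓜(V) / V`. -/
abbrev Corona (hV : ApproxUnital V) : Type _ := 𝓜(ℂ, V) ⧸ coronaIdeal V hV

variable {V}

/-- The matrix norms of the multiplier algebra of an algebra `V` with a contractive approximate
identity: `Mₙ(𝓜(V)) = 𝓜(Mₙ(V))`, with the norm of the operator of left multiplication on
`Mₙ(V)`. -/
noncomputable instance [MatrixNorms V] : MatrixNorms 𝓜(ℂ, V) where
  matNorm {n} X := sSup {r : ℝ | ∃ a : Matrix (Fin n) (Fin n) V, MatrixNorms.matNorm a ≤ 1 ∧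
    r = MatrixNorms.matNorm (Matrix.of fun i j => ∑ k, (X i k).fst (a k j))}

/-- The quotient matrix norms on the corona algebra. -/
noncomputable instance [MatrixNorms V] (hV : ApproxUnital V) : MatrixNorms (Corona V hV) where
  matNorm {n} Y := sInf {r : ℝ | ∃ X : Matrix (Fin n) (Fin n) 𝓜(ℂ, V),
    X.map (Ideal.Quotient.mk (coronaIdeal V hV)) = Y ∧ r = MatrixNorms.matNorm X}

end Corona

/-! ### The canonical map `𝒬(A) → 𝒬(V)` for a subalgebra `A` containing a cai for `V` -/

theorem completeSpace_of_isClosed {V : Type*} [NonUnitalNormedRing V] [NormedSpace ℂ V]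
    [CompleteSpace V] {S : NonUnitalSubalgebra ℂ V} (hS : IsClosed (S : Set V)) : CompleteSpace S :=
  hS.completeSpace_coe

section Inclusion

variable {V : Type*} [NonUnitalNormedRing V] [NormedSpace ℂ V] [IsScalarTower ℂ V V]
  [SMulCommClass ℂ V V] {A : NonUnitalSubalgebra ℂ V}

theorem exists_tendsto_of_approx {ι W : Type*} [NormedAddCommGroup W] (hW : CompleteSpace W)
    {l : Filter ι} [l.NeBot] (f : ι → W)
    (h : ∀ ε > 0, ∃ x, ∀ᶠ i in l, ‖f i - x‖ < ε) : ∃ y, Tendsto f l (𝓝 y) := by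
  rw [← cauchy_map_iff_exists_tendsto, Metric.cauchy_iff]
  refine ⟨inferInstance, fun ε hε => ?_⟩
  obtain ⟨x, hx⟩ := h (ε / 2) (half_pos hε)
  refine ⟨Metric.ball x (ε / 2), ?_, fun a ha b hb => ?_⟩
  · rw [mem_map]
    filter_upwards [hx] with i hi
    simpa [dist_eq_norm] using hi
  · have := dist_triangle_right a b x
    rw [Metric.mem_ball] at ha hb
    linarith

theorem exists_linear_of_tendsto {ι W : Type*} [NormedAddCommGroup W] [NormedSpace ℂ W]
    (hW : CompleteSpace W) {l : Filter ι} [l.NeBot] (f : ι → W →L[ℂ] W) (M : ℝ)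
    (hM : ∀ᶠ i in l, ∀ d, ‖f i d‖ ≤ M * ‖d‖)
    (h : ∀ d, ∀ ε > 0, ∃ x, ∀ᶠ i in l, ‖f i d - x‖ < ε) :
    ∃ L : W →L[ℂ] W, ∀ d, Tendsto (fun i => f i d) l (𝓝 (L d)) := by
  choose L hL using fun d => exists_tendsto_of_approx hW (fun i => f i d) (h d)
  refine ⟨LinearMap.mkContinuous
    { toFun := L
      map_add' := fun x y => tendsto_nhds_unique (hL (x + y))
        (((hL x).add (hL y)).congr fun i => (map_add (f i) x y).symm)
      map_smul' := fun c x => tendsto_nhds_unique (hL (c • x))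
        (((hL x).const_smul c).congr fun i => (map_smul (f i) c x).symm) } M ?_, hL⟩
  intro d
  exact le_of_tendsto (hL d).norm (hM.mono fun i hi => hi d)

theorem exists_multiplier_extension (hV : CompleteSpace V) (h : ContainsCai A) (T : 𝓜(ℂ, A)) :
    ∃ T' : 𝓜(ℂ, V), ∀ a : A, T'.fst (a : V) = T.fst a ∧ T'.snd (a : V) = T.snd a := by
  have hA := h.approxUnital
  obtain ⟨l, hl, h1⟩ := h
  have : l.NeBot := map_neBot_iff _ |>.1 hl.neBot
  have hr : ∀ d : V, Tendsto (fun e : A => d * (e : V)) l (𝓝 d) := fun d =>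
    tendsto_map'_iff.1 (hl.tendsto_mul_left d)
  have hll : ∀ d : V, Tendsto (fun e : A => (e : V) * d) l (𝓝 d) := fun d =>
    tendsto_map'_iff.1 (hl.tendsto_mul_right d)
  have hrA : ∀ d : A, Tendsto (fun e : A => d * e) l (𝓝 d) := fun d =>
    tendsto_subtype_rng.2 (hr d)
  have hlA : ∀ d : A, Tendsto (fun e : A => e * d) l (𝓝 d) := fun d =>
    tendsto_subtype_rng.2 (hll d)
  have bound : ∀ S : A →L[ℂ] A, ∀ e : A, ‖e‖ ≤ 1 → ‖((S e : A) : V)‖ ≤ ‖S‖ := fun S e he =>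
    (S.le_opNorm e).trans (mul_le_of_le_one_right (norm_nonneg _) he)
  obtain ⟨L, hL⟩ := exists_linear_of_tendsto hV (l := l)
    (fun e : A => ContinuousLinearMap.mul ℂ V ((T.fst e : A) : V)) ‖T.fst‖ (by
      filter_upwards [h1] with e he d
      exact (norm_mul_le _ _).trans
        (mul_le_mul_of_nonneg_right (bound _ e he) (norm_nonneg _))) (by
      intro d ε hε
      obtain ⟨r, hr1⟩ : ∃ r : A, ‖T.fst‖ * ‖d - r * d‖ < ε / 2 := by
        have : Tendsto (fun e : A => ‖T.fst‖ * ‖d - e * d‖) l (𝓝 (‖T.fst‖ * ‖d - d‖)) :=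
          ((tendsto_const_nhds.sub (hll d)).norm).const_mul _
        rw [sub_self, norm_zero, mul_zero] at this
        exact (this.eventually_lt_const (half_pos hε)).exists
      refine ⟨((T.fst r : A) : V) * d, ?_⟩
      have h2 : Tendsto (fun e : A => ‖(((T.fst (e * r) - T.fst r : A)) : V)‖ * ‖d‖) l (𝓝 0) := by
        have : Tendsto (fun e : A => T.fst (e * r) - T.fst r) l (𝓝 0) := by
          have := ((T.fst.continuous.tendsto r).comp (hlA r)).sub_const (T.fst r)
          simpa using this
        have := (this.norm).mul_const ‖d‖
        rwa [norm_zero, zero_mul] at this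
      filter_upwards [h1, h2.eventually_lt_const (half_pos hε)] with e he he2
      have e1 : ((T.fst e : A) : V) * d - ((T.fst r : A) : V) * d =
          ((T.fst e : A) : V) * (d - r * d) + (((T.fst (e * r) - T.fst r : A)) : V) * d := by
        rw [hA.fst_mul]; push_cast; noncomm_ring
      change ‖((T.fst e : A) : V) * d - ((T.fst r : A) : V) * d‖ < ε
      rw [e1]
      have a1 := norm_add_le (((T.fst e : A) : V) * (d - r * d))
        ((((T.fst (e * r) - T.fst r : A)) : V) * d)
      have a2 := norm_mul_le ((T.fst e : A) : V) (d - r * d)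
      have a3 := norm_mul_le ((((T.fst (e * r) - T.fst r : A)) : V)) d
      have a4 := mul_le_mul_of_nonneg_right (bound T.fst e he) (norm_nonneg (d - r * d))
      linarith)
  obtain ⟨R, hR⟩ := exists_linear_of_tendsto hV (l := l)
    (fun e : A => (ContinuousLinearMap.mul ℂ V).flip ((T.snd e : A) : V)) ‖T.snd‖ (by
      filter_upwards [h1] with e he d
      refine (norm_mul_le _ _).trans ?_
      rw [mul_comm]
      exact mul_le_mul_of_nonneg_right (bound _ e he) (norm_nonneg _)) (by
      intro d ε hε
      obtain ⟨r, hr1⟩ : ∃ r : A, ‖T.snd‖ * ‖d - d * r‖ < ε / 2 := by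
        have : Tendsto (fun e : A => ‖T.snd‖ * ‖d - d * e‖) l (𝓝 (‖T.snd‖ * ‖d - d‖)) :=
          ((tendsto_const_nhds.sub (hr d)).norm).const_mul _
        rw [sub_self, norm_zero, mul_zero] at this
        exact (this.eventually_lt_const (half_pos hε)).exists
      refine ⟨d * ((T.snd r : A) : V), ?_⟩
      have h2 : Tendsto (fun e : A => ‖(((T.snd (r * e) - T.snd r : A)) : V)‖ * ‖d‖) l (𝓝 0) := by
        have : Tendsto (fun e : A => T.snd (r * e) - T.snd r) l (𝓝 0) := by
          have := ((T.snd.continuous.tendsto r).comp (hrA r)).sub_const (T.snd r)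
          simpa using this
        have := (this.norm).mul_const ‖d‖
        rwa [norm_zero, zero_mul] at this
      filter_upwards [h1, h2.eventually_lt_const (half_pos hε)] with e he he2
      have e1 : d * ((T.snd e : A) : V) - d * ((T.snd r : A) : V) =
          (d - d * r) * ((T.snd e : A) : V) + d * (((T.snd (r * e) - T.snd r : A)) : V) := by
        rw [hA.snd_mul]; push_cast; noncomm_ring
      change ‖d * ((T.snd e : A) : V) - d * ((T.snd r : A) : V)‖ < ε
      rw [e1]
      have a1 := norm_add_le ((d - d * r) * ((T.snd e : A) : V))
        (d * (((T.snd (r * e) - T.snd r : A)) : V))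
      have a2 := norm_mul_le (d - d * r) ((T.snd e : A) : V)
      have a3 := norm_mul_le d ((((T.snd (r * e) - T.snd r : A)) : V))
      have a4 := mul_le_mul_of_nonneg_right (bound T.snd e he) (norm_nonneg (d - d * r))
      linarith)
  have hL' : ∀ d, Tendsto (fun e : A => ((T.fst e : A) : V) * d) l (𝓝 (L d)) := hL
  have hR' : ∀ d, Tendsto (fun e : A => d * ((T.snd e : A) : V)) l (𝓝 (R d)) := hR
  refine ⟨⟨(L, R), fun x y => ?_⟩, fun a => ⟨?_, ?_⟩⟩
  · have key : ∀ e : A, ((T.snd e : A) : V) * y = e * L y := fun e => by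
      refine tendsto_nhds_unique ((hll y).const_mul ((T.snd e : A) : V))
        (((hL' y).const_mul (e : V)).congr fun s => ?_)
      have := congrArg (fun z : A => (z : V)) (T.central e s)
      simp only [NonUnitalSubalgebra.coe_mul] at this
      rw [← mul_assoc, ← mul_assoc, this]
    refine tendsto_nhds_unique ((hR' x).mul_const y) (((hll (L y)).const_mul x).congr fun e => ?_)
    rw [← key, mul_assoc]
  · refine tendsto_nhds_unique (hL' a) ?_
    have := (continuous_subtype_val.tendsto _).comp ((T.fst.continuous.tendsto a).comp (hlA a))
    refine this.congr fun e => ?_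
    simp [hA.fst_mul]
  · refine tendsto_nhds_unique (hR' a) ?_
    have := (continuous_subtype_val.tendsto _).comp ((T.snd.continuous.tendsto a).comp (hrA a))
    refine this.congr fun e => ?_
    simp [hA.snd_mul]

theorem multiplier_ext (h : ContainsCai A) {S T : 𝓜(ℂ, V)}
    (hST : ∀ a : A, S.fst (a : V) = T.fst a ∧ S.snd (a : V) = T.snd a) : S = T := by
  obtain ⟨l, hl, -⟩ := h
  have : l.NeBot := map_neBot_iff _ |>.1 hl.neBot
  have hr : ∀ d : V, Tendsto (fun e : A => d * (e : V)) l (𝓝 d) := fun d =>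
    tendsto_map'_iff.1 (hl.tendsto_mul_left d)
  have hll : ∀ d : V, Tendsto (fun e : A => (e : V) * d) l (𝓝 d) := fun d =>
    tendsto_map'_iff.1 (hl.tendsto_mul_right d)
  ext x
  · refine tendsto_nhds_unique (hll (S.fst x)) ((hll (T.fst x)).congr fun e => ?_)
    rw [← S.central, ← T.central, (hST e).2]
  · refine tendsto_nhds_unique (hr (S.snd x)) ((hr (T.snd x)).congr fun e => ?_)
    rw [S.central, T.central, (hST e).1]

/-- The multiplier of `V` that agrees on `A` with the multiplier `T` of `A`, for `A` containing a
cai for `V`. It is unique by `multiplier_ext`. -/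
noncomputable def multiplierExtension (hV : CompleteSpace V) (h : ContainsCai A) (T : 𝓜(ℂ, A)) :
    𝓜(ℂ, V) :=
  Classical.choose (exists_multiplier_extension hV h T)

theorem multiplierExtension_fst (hV : CompleteSpace V) (h : ContainsCai A) (T : 𝓜(ℂ, A))
    (a : A) : (multiplierExtension hV h T).fst (a : V) = T.fst a :=
  (Classical.choose_spec (exists_multiplier_extension hV h T) a).1

theorem multiplierExtension_snd (hV : CompleteSpace V) (h : ContainsCai A) (T : 𝓜(ℂ, A))
    (a : A) : (multiplierExtension hV h T).snd (a : V) = T.snd a :=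
  (Classical.choose_spec (exists_multiplier_extension hV h T) a).2

/-- The canonical unital morphism `𝓜(A) → 𝓜(V)` extending the inclusion `A ⊆ V`. -/
noncomputable def multiplierInclusion (hV : CompleteSpace V) (h : ContainsCai A) :
    𝓜(ℂ, A) →ₐ[ℂ] 𝓜(ℂ, V) where
  toFun := multiplierExtension hV h
  map_one' := multiplier_ext h fun a => by
    simp [multiplierExtension_fst, multiplierExtension_snd]
  map_mul' S T := multiplier_ext h fun a => by
    simp [multiplierExtension_fst, multiplierExtension_snd]
  map_zero' := multiplier_ext h fun a => by
    simp [multiplierExtension_fst, multiplierExtension_snd]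
  map_add' S T := multiplier_ext h fun a => by
    simp [multiplierExtension_fst, multiplierExtension_snd]
  commutes' c := multiplier_ext h fun a => by
    simp [multiplierExtension_fst, multiplierExtension_snd, Algebra.algebraMap_eq_smul_one]

/-- The canonical morphism `𝒬(A) → 𝒬(V)` induced by `𝓜(A) → 𝓜(V)`. -/
noncomputable def coronaInclusion (hV : CompleteSpace V) (h : ContainsCai A)
    (hV' : ApproxUnital V) : Corona A h.approxUnital →ₐ[ℂ] Corona V hV' :=
  Ideal.quotientMapₐ (coronaIdeal V hV') (multiplierInclusion hV h) (by
    rintro _ ⟨a, rfl⟩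
    refine ⟨(a : V), (multiplier_ext h fun x => ?_).symm⟩
    change (multiplierExtension hV h _).fst _ = _ ∧ (multiplierExtension hV h _).snd _ = _
    simp [multiplierExtension_fst, multiplierExtension_snd])

theorem coronaInclusion_mk (hV : CompleteSpace V) (h : ContainsCai A) (hV' : ApproxUnital V)
    (T : 𝓜(ℂ, A)) : coronaInclusion hV h hV' (Ideal.Quotient.mk _ T) =
      Ideal.Quotient.mk _ (multiplierExtension hV h T) := rfl

end Inclusion

/-! ### Extensions and their Busby invariants -/

section Extension

variable {D E F : Type*}
  [NonUnitalNormedRing D] [NormedSpace ℂ D] [MatrixNorms D]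
  [NonUnitalNormedRing E] [NormedSpace ℂ E] [MatrixNorms E]
  [NonUnitalNormedRing F] [NormedSpace ℂ F] [MatrixNorms F]

/-- The sequence `0 → D → E → F → 0` with maps `α`, `β` is an extension in the category `𝒦`: it is
exact, `D` and `F` are nonzero, `D` has a contractive approximate identity, `α` is completely
isometric and `β` is a complete quotient map. -/
structure IsExtension (𝒦 : OpAlgCategory) (α : D →ₙₐ[ℂ] E) (β : E →ₙₐ[ℂ] F) : Prop where
  nontrivial_left : Nontrivial D
  nontrivial_right : Nontrivial F
  approxUnital : ApproxUnital D
  isObject_middle : 𝒦.IsObject E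
  isObject_right : 𝒦.IsObject F
  isCompleteIsometry : IsCompleteIsometry α
  exact : Function.Exact α β
  isCompleteQuotientMap : IsCompleteQuotientMap β

namespace IsExtension

variable {𝒦 : OpAlgCategory} {α : D →ₙₐ[ℂ] E} {β : E →ₙₐ[ℂ] F}

theorem norm_map [LawfulMatrixNorms D] [LawfulMatrixNorms E] (h : IsExtension 𝒦 α β) (d : D) :
    ‖α d‖ = ‖d‖ := by
  rw [← LawfulMatrixNorms.matNorm_one, ← LawfulMatrixNorms.matNorm_one,
    ← h.isCompleteIsometry 1 (Matrix.of fun _ _ => d)]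
  rfl

theorem injective [LawfulMatrixNorms D] [LawfulMatrixNorms E] (h : IsExtension 𝒦 α β) :
    Function.Injective α := by
  refine (injective_iff_map_eq_zero α).2 fun d hd => ?_
  rw [← norm_eq_zero, ← h.norm_map, hd, norm_zero]

theorem surjective [LawfulMatrixNorms F] (h : IsExtension 𝒦 α β) : Function.Surjective β := by
  intro c
  have hpos : 0 < ‖c‖ + 1 := by positivity
  have hne : ((‖c‖ + 1 : ℝ) : ℂ) ≠ 0 := by exact_mod_cast hpos.ne'
  have hmem : (Matrix.of fun _ _ : Fin 1 => ((‖c‖ + 1 : ℝ) : ℂ)⁻¹ • c) ∈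
      {Y : Matrix (Fin 1) (Fin 1) F | MatrixNorms.matNorm Y < 1} := by
    change MatrixNorms.matNorm _ < 1
    rw [LawfulMatrixNorms.matNorm_one, norm_smul, norm_inv,
      Complex.norm_of_nonneg hpos.le, inv_mul_lt_iff₀ hpos]
    linarith
  rw [← h.isCompleteQuotientMap 1] at hmem
  obtain ⟨X, -, hX⟩ := hmem
  refine ⟨((‖c‖ + 1 : ℝ) : ℂ) • X 0 0, ?_⟩
  have hX' : β (X 0 0) = ((‖c‖ + 1 : ℝ) : ℂ)⁻¹ • c := congrFun (congrFun hX 0) 0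
  rw [map_smul, hX', smul_smul, mul_inv_cancel₀ hne, one_smul]

variable [IsScalarTower ℂ D D] [SMulCommClass ℂ D D]
  [LawfulMatrixNorms D] [LawfulMatrixNorms E]

theorem multiplier_eq (h : IsExtension 𝒦 α β) {S T : 𝓜(ℂ, D)}
    (hST : ∀ d, α (S.fst d) = α (T.fst d) ∧ α (S.snd d) = α (T.snd d)) : S = T := by
  ext d
  · exact h.injective (hST d).1
  · exact h.injective (hST d).2

variable [IsScalarTower ℂ E E] [SMulCommClass ℂ E E]

theorem exists_multiplier (h : IsExtension 𝒦 α β) (b : E) :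
    ∃ T : 𝓜(ℂ, D), ∀ d, α (T.fst d) = b * α d ∧ α (T.snd d) = α d * b := by
  have hk : ∀ d, β (α d) = 0 := fun d => (h.exact (α d)).2 ⟨d, rfl⟩
  choose L hL using fun d => (h.exact (b * α d)).1 (by rw [map_mul, hk, mul_zero])
  choose R hR using fun d => (h.exact (α d * b)).1 (by rw [map_mul, hk, zero_mul])
  refine ⟨⟨(LinearMap.mkContinuous
    { toFun := L
      map_add' := fun x y => h.injective (by simp [hL, mul_add])
      map_smul' := fun c x => h.injective (by simp [hL, map_smul, mul_smul_comm]) } ‖b‖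
        fun x => ?_,
    LinearMap.mkContinuous
    { toFun := R
      map_add' := fun x y => h.injective (by simp [hR, add_mul])
      map_smul' := fun c x => h.injective (by simp [hR, map_smul, smul_mul_assoc]) } ‖b‖
        fun x => ?_), fun x y => h.injective ?_⟩,
    fun d => ⟨hL d, hR d⟩⟩
  · change ‖L x‖ ≤ _
    rw [← h.norm_map, hL, ← h.norm_map x]
    exact norm_mul_le _ _
  · change ‖R x‖ ≤ _
    rw [← h.norm_map, hR, ← h.norm_map x, mul_comm]
    exact norm_mul_le _ _
  · change α (R x * y) = α (x * L y)
    rw [map_mul, map_mul, hL, hR, mul_assoc]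

/-- The multiplier of `D` given by an element `b` of the middle term, with left multiplication
`d ↦ α⁻¹(b α(d))` and right multiplication `d ↦ α⁻¹(α(d) b)`. -/
noncomputable def toMultiplier (h : IsExtension 𝒦 α β) (b : E) : 𝓜(ℂ, D) :=
  Classical.choose (h.exists_multiplier b)

theorem toMultiplier_fst (h : IsExtension 𝒦 α β) (b : E) (d : D) :
    α ((h.toMultiplier b).fst d) = b * α d :=
  (Classical.choose_spec (h.exists_multiplier b) d).1

theorem toMultiplier_snd (h : IsExtension 𝒦 α β) (b : E) (d : D) :
    α ((h.toMultiplier b).snd d) = α d * b :=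
  (Classical.choose_spec (h.exists_multiplier b) d).2

/-- The canonical morphism `σ : E → 𝓜(D)` of an extension. -/
noncomputable def sigma (h : IsExtension 𝒦 α β) : E →ₙₐ[ℂ] 𝓜(ℂ, D) where
  toFun := h.toMultiplier
  map_smul' c b := h.multiplier_eq fun d => by
    simp [toMultiplier_fst, toMultiplier_snd, map_smul, smul_mul_assoc, mul_smul_comm]
  map_zero' := h.multiplier_eq fun d => by
    simp [toMultiplier_fst, toMultiplier_snd]
  map_add' b b' := h.multiplier_eq fun d => by
    simp [toMultiplier_fst, toMultiplier_snd, add_mul, mul_add]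
  map_mul' b b' := h.multiplier_eq fun d => by
    simp [toMultiplier_fst, toMultiplier_snd, mul_assoc]

theorem mk_sigma_eq (h : IsExtension 𝒦 α β) {b b' : E} (hb : β b = β b') :
    Ideal.Quotient.mk (coronaIdeal D h.approxUnital) (h.sigma b) =
      Ideal.Quotient.mk (coronaIdeal D h.approxUnital) (h.sigma b') := by
  obtain ⟨d, hd⟩ := (h.exact (b - b')).1 (by rw [map_sub, hb, sub_self])
  refine Ideal.Quotient.eq.2 ⟨d, ?_⟩
  rw [← map_sub, ← hd]
  refine h.multiplier_eq fun x => ?_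
  change _ = α ((h.toMultiplier _).fst x) ∧ _ = α ((h.toMultiplier _).snd x)
  simp [toMultiplier_fst, toMultiplier_snd]

/-- The Busby invariant `τ : F → 𝒬(D)` of an extension: `τ(β(b)) = σ(b) + D`, where
`σ(b)(d) = α⁻¹(b α(d))`; see `busby_apply`. -/
noncomputable def busby [LawfulMatrixNorms F] (h : IsExtension 𝒦 α β) : F →ₙₐ[ℂ] Corona D h.approxUnital :=
  have hs : ∀ c, β (Function.surjInv h.surjective c) = c := Function.surjInv_eq h.surjective
  { toFun := fun c => Ideal.Quotient.mk _ (h.sigma (Function.surjInv h.surjective c))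
    map_smul' := fun r c => by
      rw [h.mk_sigma_eq (b' := r • Function.surjInv h.surjective c) (by simp [hs, map_smul]),
        map_smul]
      rfl
    map_zero' := by
      rw [h.mk_sigma_eq (b' := 0) (by simp [hs]), map_zero, map_zero]
    map_add' := fun c c' => by
      rw [h.mk_sigma_eq (b' := Function.surjInv h.surjective c +
        Function.surjInv h.surjective c') (by simp [hs]), map_add, map_add]
    map_mul' := fun c c' => by
      rw [h.mk_sigma_eq (b' := Function.surjInv h.surjective c *
        Function.surjInv h.surjective c') (by simp [hs]), map_mul, map_mul] }

theorem busby_apply [LawfulMatrixNorms F] (h : IsExtension 𝒦 α β) (b : E) :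
    h.busby (β b) = Ideal.Quotient.mk (coronaIdeal D h.approxUnital) (h.sigma b) :=
  h.mk_sigma_eq (Function.surjInv_eq h.surjective (β b))

end IsExtension

/-! ### Subextensions -/

/-- The restriction `A → B` of a homomorphism `f` with `f(A) ⊆ B`. -/
def restrictHom (f : D →ₙₐ[ℂ] E) (A : NonUnitalSubalgebra ℂ D) (B : NonUnitalSubalgebra ℂ E)
    (hf : ∀ a ∈ A, f a ∈ B) : A →ₙₐ[ℂ] B :=
  NonUnitalAlgHom.codRestrict (f.comp (NonUnitalSubalgebraClass.subtype A)) B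
    fun a => hf a a.2

/-- Closed subalgebras `A`, `B`, `C` of `D`, `E`, `F` form a subextension: the restrictions of `α`
and `β` make `0 → A → B → C → 0` an extension in the category `𝒦`. -/
structure IsSubextension (𝒦 : OpAlgCategory) (α : D →ₙₐ[ℂ] E) (β : E →ₙₐ[ℂ] F)
    (A : NonUnitalSubalgebra ℂ D) (B : NonUnitalSubalgebra ℂ E) (C : NonUnitalSubalgebra ℂ F) :
    Prop where
  isClosed_left : IsClosed (A : Set D)
  isClosed_middle : IsClosed (B : Set E)
  isClosed_right : IsClosed (C : Set F)
  map_left : ∀ a ∈ A, α a ∈ B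
  map_middle : ∀ b ∈ B, β b ∈ C
  isExtension : IsExtension 𝒦 (restrictHom α A B map_left) (restrictHom β B C map_middle)

/-- The set of `b ∈ E` with `bA + Ab ⊆ A`, where `A ⊆ D` is identified with `α(A) ⊆ E`. -/
def idealizer (α : D →ₙₐ[ℂ] E) (A : NonUnitalSubalgebra ℂ D) : Set E :=
  {b | ∀ a ∈ A, ∀ a' ∈ A, b * α a + α a' * b ∈ α '' (A : Set D)}

end Extension

end OpAlg

set_option linter.unusedSectionVars false

open Filter Topology MultiplierAlgebra

namespace OpAlg

/-! The norm estimates rest on one device: elements `f` of `A` for which `1 - f` has norm nearly 1.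
For a contraction `e` the norm of `1 - e` can be 2, but `f = δ e (1 + δ - e)⁻¹` is again a
contraction in the algebra, satisfies `‖1 - f‖ ≤ 1 + δ` on Hilbert space, and for fixed `δ` runs
through a cai when `e` does (`ContainsCai.exists_regularized`). Suppose a matrix `X` differs from a
matrix `X₀` of controlled norm by a matrix `G` over `D`. Then `X(1 - f) = X₀(1 - f) + G(1 - f)`,
where the first term has norm at most `(1 + δ)‖X₀‖` and the second tends to 0. If `X` is a matrix of
multipliers of `A` or of elements of the idealizer, `Xf` has entries in `A`, so the class modulo `A`
is unchanged. This gives the hard inequality for `j` (`exists_matNorm_le_of_coronaInclusion`) and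
the complete quotient property of the restricted `β` (`IsExtension.isCompleteQuotientMap_restrict`).

The bijection itself is algebra. In a subextension `α(A)` is the kernel of `β` on `B`, hence an
ideal of `B`, so `B` lies in the idealizer. Conversely, `α(d)` is in the idealizer only if `d` is in
`A`, since `d` is the limit of `d e` along the cai in `A`. Thus `B` and `{b ∈ β⁻¹(C) : bA + Ab ⊆ A}`
have the same image and the same kernel under `β`, and coincide. The Busby invariants agree because
multiplication by `b ∈ B` on `D` extends multiplication by `b` on `A`.

For approximately unital algebras the middle term must also be shown to have a cai
(`approxUnital_of_exact`). If `x` lifts an approximate unit of `C`, then `e + (1 - e)x` is almost a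
left unit, but its norm may be too large and it need not be almost a right unit. Both defects are
repaired in `exists_nearUnit_of_ideal` by averaging `e (2k) + (1 - e (2k + 2)) x` over `k`, for a
sequence `e` in the ideal each of whose terms is almost a unit for the earlier ones: near
orthogonality controls the norms and the commutators, and the mismatch of indices telescopes. -/

/-! ### Regularized contractions -/

section Regularization

/-- `f = δ e (1 + δ - e)⁻¹` for a contraction `e`; on a Hilbert space this gives
`‖1 - f‖ ≤ 1 + δ`. -/
def IsRegularized {V : Type*} [NonUnitalNormedRing V] [NormedSpace ℂ V] (δ : ℝ) (f : V) : Prop :=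
  ∃ e : V, ‖e‖ ≤ 1 ∧ ((1 + δ : ℝ) : ℂ) • f = (δ : ℂ) • e + f * e

theorem IsRegularized.map {V W : Type*} [NonUnitalNormedRing V] [NormedSpace ℂ V]
    [NonUnitalNormedRing W] [NormedSpace ℂ W] {φ : V →ₙₐ[ℂ] W}
    (hφ : ∀ v, ‖φ v‖ ≤ ‖v‖) {δ : ℝ} {f : V} (hf : IsRegularized δ f) : IsRegularized δ (φ f) := by
  obtain ⟨e, he, h⟩ := hf
  refine ⟨φ e, (hφ e).trans he, ?_⟩
  rw [← map_smul, h, map_add, map_smul, map_mul]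

variable {V : Type*} [NonUnitalNormedRing V] [NormedSpace ℂ V] [IsScalarTower ℂ V V]
  [SMulCommClass ℂ V V]

theorem exists_regularization (hV : CompleteSpace V) {e : V} (he : ‖e‖ ≤ 1) {δ : ℝ} (hδ : 0 < δ) :
    ∃ f : V, ‖f‖ ≤ 1 ∧ ((1 + δ : ℝ) : ℂ) • f = (δ : ℂ) • e + e * f ∧ e * f = f * e := by
  have h1 : 0 < 1 + δ := by positivity
  have h1n : ‖((1 + δ : ℝ) : ℂ)‖ = 1 + δ := Complex.norm_of_nonneg h1.le
  have h1c : ((1 + δ : ℝ) : ℂ) ≠ 0 := by exact_mod_cast h1.ne'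
  -- Since `V` may have no unit, `(1 + δ - e)⁻¹` is avoided: `f` is the fixed point of an affine map
  -- with Lipschitz constant `(1 + δ)⁻¹`.
  let g : V → V := fun f => ((1 + δ : ℝ) : ℂ)⁻¹ • ((δ : ℂ) • e + e * f)
  have hg : ContractingWith ⟨(1 + δ)⁻¹, by positivity⟩ g := by
    refine ⟨NNReal.coe_lt_coe.1 <| by
      exact inv_lt_one_of_one_lt₀ (by linarith),
      LipschitzWith.of_dist_le_mul fun x y => ?_⟩
    rw [dist_eq_norm, dist_eq_norm, ← smul_sub, norm_smul, norm_inv, h1n, add_sub_add_left_eq_sub,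
      ← mul_sub]
    refine mul_le_mul_of_nonneg_left ((norm_mul_le _ _).trans ?_) (by positivity)
    exact mul_le_of_le_one_left (norm_nonneg _) he
  obtain ⟨f, hf⟩ : ∃ f, g f = f := ⟨_, hg.fixedPoint_isFixedPt⟩
  have hf' : ((1 + δ : ℝ) : ℂ) • f = (δ : ℂ) • e + e * f := by
    conv_lhs => rw [← hf]
    simp only [g, smul_smul, mul_inv_cancel₀ h1c, one_smul]
  refine ⟨f, ?_, hf', ?_⟩
  · have := congrArg norm hf'
    rw [norm_smul, h1n] at this
    have h2 := norm_add_le ((δ : ℂ) • e) (e * f)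
    have h3 := norm_mul_le e f
    rw [norm_smul, Complex.norm_of_nonneg hδ.le] at h2
    have h4 := mul_le_mul_of_nonneg_left he hδ.le
    have h5 := mul_le_of_le_one_left (norm_nonneg f) he
    have : δ * ‖f‖ ≤ δ * 1 := by linarith
    exact le_of_mul_le_mul_left this hδ
  -- The commutator is multiplied by `1 + δ` under a contraction, so it vanishes; hence the equation
  -- holds with `e` on either side of `f`.
  · have h2 : ((1 + δ : ℝ) : ℂ) • (e * f - f * e) = e * (e * f - f * e) := by
      rw [smul_sub, ← mul_smul_comm, ← smul_mul_assoc, hf', mul_add, add_mul, mul_sub,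
        mul_smul_comm, smul_mul_assoc, mul_assoc]
      abel
    have h3 := congrArg norm h2
    rw [norm_smul, h1n] at h3
    have h4 := (norm_mul_le e (e * f - f * e)).trans (mul_le_of_le_one_left (norm_nonneg _) he)
    have h5 : δ * ‖e * f - f * e‖ ≤ 0 := by linarith
    have h6 : ‖e * f - f * e‖ ≤ 0 := by
      by_contra h
      exact absurd h5 (not_le.2 (mul_pos hδ (not_le.1 h)))
    exact sub_eq_zero.1 (norm_le_zero_iff.1 h6)

/-- The equation for `f` gives `δ(d - df) = δ(d - de) + (d - de)f`. With `δ` fixed, `f` is therefore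
an approximate unit along any filter for which `e` is one. -/
theorem norm_sub_mul_right_le {e f d : V} {δ : ℝ} (hδ : 0 < δ) (hf : ‖f‖ ≤ 1)
    (h : ((1 + δ : ℝ) : ℂ) • f = (δ : ℂ) • e + e * f) :
    ‖d - d * f‖ ≤ δ⁻¹ * (1 + δ) * ‖d - d * e‖ := by
  have h1 : (δ : ℂ) • (d - d * f) = (δ : ℂ) • (d - d * e) + (d - d * e) * f := by
    have := congrArg (fun z => d * z) h
    simp only [mul_smul_comm, mul_add, Complex.ofReal_add, Complex.ofReal_one, add_smul,
      one_smul] at this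
    simp only [smul_sub, sub_mul, mul_assoc]
    linear_combination (norm := module) (-1 : ℂ) • this
  have h2 := congrArg norm h1
  rw [norm_smul, Complex.norm_of_nonneg hδ.le] at h2
  have h3 := norm_add_le ((δ : ℂ) • (d - d * e)) ((d - d * e) * f)
  rw [norm_smul, Complex.norm_of_nonneg hδ.le] at h3
  have h4 := (norm_mul_le (d - d * e) f).trans (mul_le_of_le_one_right (norm_nonneg _) hf)
  rw [mul_assoc, inv_mul_eq_div, le_div_iff₀ hδ]
  linarith

theorem norm_sub_mul_left_le {e f d : V} {δ : ℝ} (hδ : 0 < δ) (hf : ‖f‖ ≤ 1)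
    (h : ((1 + δ : ℝ) : ℂ) • f = (δ : ℂ) • e + f * e) :
    ‖d - f * d‖ ≤ δ⁻¹ * (1 + δ) * ‖d - e * d‖ := by
  have h1 : (δ : ℂ) • (d - f * d) = (δ : ℂ) • (d - e * d) + f * (d - e * d) := by
    have := congrArg (fun z => z * d) h
    simp only [smul_mul_assoc, add_mul, Complex.ofReal_add, Complex.ofReal_one, add_smul,
      one_smul] at this
    simp only [smul_sub, mul_sub, ← mul_assoc]
    linear_combination (norm := module) (-1 : ℂ) • this
  have h2 := congrArg norm h1
  rw [norm_smul, Complex.norm_of_nonneg hδ.le] at h2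
  have h3 := norm_add_le ((δ : ℂ) • (d - e * d)) (f * (d - e * d))
  rw [norm_smul, Complex.norm_of_nonneg hδ.le] at h3
  have h4 := (norm_mul_le f (d - e * d)).trans (mul_le_of_le_one_left (norm_nonneg _) hf)
  rw [mul_assoc, inv_mul_eq_div, le_div_iff₀ hδ]
  linarith

/-- A contractive approximate identity can be chosen to consist of regularized elements. -/
theorem ContainsCai.exists_regularized {A : NonUnitalSubalgebra ℂ V} (hA : CompleteSpace A)
    (h : ContainsCai A) {δ : ℝ} (hδ : 0 < δ) :
    ∃ l : Filter A, (l.map (fun x : A => (x : V))).IsApproximateUnit ∧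
      ∀ᶠ f in l, ‖f‖ ≤ 1 ∧ IsRegularized δ f := by
  obtain ⟨l, hl, h1⟩ := h
  have hne : l.NeBot := map_neBot_iff _ |>.1 hl.neBot
  have key : ∀ e : A, ∃ f : A, ‖e‖ ≤ 1 → (‖f‖ ≤ 1 ∧
      ((1 + δ : ℝ) : ℂ) • f = (δ : ℂ) • e + e * f ∧ e * f = f * e) := fun e => by
    by_cases he : ‖e‖ ≤ 1
    · obtain ⟨f, hf⟩ := exists_regularization hA he hδ
      exact ⟨f, fun _ => hf⟩
    · exact ⟨0, fun h => absurd h he⟩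
  choose f hf using key
  refine ⟨l.map f,
    { tendsto_mul_left := fun d => ?_, tendsto_mul_right := fun d => ?_, neBot := ?_ }, ?_⟩
  · rw [map_map, tendsto_map'_iff, tendsto_iff_norm_sub_tendsto_zero]
    have h0 : Tendsto (fun e : A => δ⁻¹ * (1 + δ) * ‖d - d * (e : V)‖) l (𝓝 0) := by
      have := (((tendsto_map'_iff.1 (hl.tendsto_mul_left d)).const_sub d).norm).const_mul
        (δ⁻¹ * (1 + δ))
      simpa using this
    refine squeeze_zero' (Eventually.of_forall fun _ => norm_nonneg _) ?_ h0
    filter_upwards [h1] with e he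
    rw [norm_sub_rev]
    exact norm_sub_mul_right_le hδ (hf e he).1 (congrArg Subtype.val (hf e he).2.1)
  · rw [map_map, tendsto_map'_iff, tendsto_iff_norm_sub_tendsto_zero]
    have h0 : Tendsto (fun e : A => δ⁻¹ * (1 + δ) * ‖d - (e : V) * d‖) l (𝓝 0) := by
      have := (((tendsto_map'_iff.1 (hl.tendsto_mul_right d)).const_sub d).norm).const_mul
        (δ⁻¹ * (1 + δ))
      simpa using this
    refine squeeze_zero' (Eventually.of_forall fun _ => norm_nonneg _) ?_ h0
    filter_upwards [h1] with e he
    rw [norm_sub_rev]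
    refine norm_sub_mul_left_le hδ (hf e he).1 ?_
    have := (hf e he).2.1
    rw [(hf e he).2.2] at this
    exact congrArg Subtype.val this
  · exact (hne.map f).map _
  · rw [eventually_map]
    filter_upwards [h1] with e he
    refine ⟨(hf e he).1, e, he, ?_⟩
    rw [← (hf e he).2.2]
    exact (hf e he).2.1

end Regularization

/-! ### Hilbert space estimates for regularized contractions and operator matrices -/

section Hilbert

variable {H : Type*} [NormedAddCommGroup H] [InnerProductSpace ℂ H]

/-- For a contraction `Re ⟨z - Ez, z⟩ ≥ 0`, so adding `δz` to `z - Ez` cannot shorten it. -/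
theorem norm_sub_apply_le_of_norm_le_one {E : H →L[ℂ] H} (hE : ‖E‖ ≤ 1) {δ : ℝ} (hδ : 0 < δ)
    (z : H) : ‖z - E z‖ ≤ ‖((1 + δ : ℝ) : ℂ) • z - E z‖ := by
  have h1 : ((1 + δ : ℝ) : ℂ) • z - E z = (z - E z) + (δ : ℂ) • z := by
    push_cast; rw [add_smul, one_smul]; abel
  have h2 : 0 ≤ RCLike.re (inner ℂ (z - E z) z) := by
    rw [inner_sub_left, map_sub, inner_self_eq_norm_sq (𝕜 := ℂ)]
    have a := re_inner_le_norm (𝕜 := ℂ) (E z) z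
    have b := (E.le_opNorm z).trans (mul_le_of_le_one_left (norm_nonneg _) hE)
    nlinarith [norm_nonneg z]
  have h3 := norm_add_sq (𝕜 := ℂ) (z - E z) ((δ : ℂ) • z)
  rw [inner_smul_right, ← Complex.coe_algebraMap] at h3
  have h4 : 0 ≤ RCLike.re ((algebraMap ℝ ℂ) δ * inner ℂ (z - E z) z) := by
    rw [Complex.coe_algebraMap]
    simpa using mul_nonneg hδ.le h2
  rw [h1]
  refine le_of_sq_le_sq ?_ (norm_nonneg _)
  rw [← Complex.coe_algebraMap, h3]
  nlinarith [sq_nonneg ‖(algebraMap ℝ ℂ) δ • z‖]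

/-- Formally `1 - F = (1 + δ)(1 - E)(1 + δ - E)⁻¹`. The inverse exists by the Neumann series, so
every vector is `(1 + δ)z - Ez` for some `z`, and the preceding estimate applies. -/
theorem IsRegularized.norm_one_sub_le [CompleteSpace H] {F : H →L[ℂ] H} {δ : ℝ} (hδ : 0 < δ)
    (hF : IsRegularized δ F) : ‖1 - F‖ ≤ 1 + δ := by
  obtain ⟨E, hE, h⟩ := hF
  have h1 : 0 < 1 + δ := by positivity
  have h1n : ‖((1 + δ : ℝ) : ℂ)‖ = 1 + δ := Complex.norm_of_nonneg h1.le
  have h1c : ((1 + δ : ℝ) : ℂ) ≠ 0 := by exact_mod_cast h1.ne'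
  have hu : IsUnit (1 - ((1 + δ : ℝ) : ℂ)⁻¹ • E) := by
    refine isUnit_one_sub_of_norm_lt_one ?_
    rw [norm_smul, norm_inv, h1n, inv_mul_lt_iff₀ h1]
    linarith
  obtain ⟨u, hu⟩ := hu
  refine ContinuousLinearMap.opNorm_le_bound _ h1.le fun x => ?_
  obtain ⟨z, rfl⟩ : ∃ z, ((1 + δ : ℝ) : ℂ) • z - E z = x := by
    refine ⟨((1 + δ : ℝ) : ℂ)⁻¹ • (↑u⁻¹ : H →L[ℂ] H) x, ?_⟩
    have := congrArg (fun T : H →L[ℂ] H => T x) u.mul_inv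
    simp only [hu, mul_apply_eq_comp, sub_apply,
      one_apply_eq_self, smul_apply] at this
    rw [smul_smul, mul_inv_cancel₀ h1c, one_smul, map_smul, this]
  have h2 : (1 - F) (((1 + δ : ℝ) : ℂ) • z - E z) = ((1 + δ : ℝ) : ℂ) • (z - E z) := by
    have := congrArg (fun T : H →L[ℂ] H => T z) h
    simp only [mul_apply_eq_comp, add_apply,
      smul_apply] at this
    rw [sub_apply, one_apply_eq_self, map_sub, map_smul, this]
    push_cast
    module
  rw [h2, norm_smul, h1n]
  exact mul_le_mul_of_nonneg_left (norm_sub_apply_le_of_norm_le_one hE hδ z) h1.le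

theorem matrixOperator_mul {n : ℕ} (X Y : Matrix (Fin n) (Fin n) (H →L[ℂ] H)) :
    matrixOperator (X * Y) = matrixOperator X * matrixOperator Y := by
  ext ξ i
  simp only [mul_apply_eq_comp, matrixOperator_apply, Matrix.mul_apply, map_sum,
    sum_apply]
  rw [Finset.sum_comm]

theorem matrixOperator_add {n : ℕ} (X Y : Matrix (Fin n) (Fin n) (H →L[ℂ] H)) :
    matrixOperator (X + Y) = matrixOperator X + matrixOperator Y := by
  ext ξ i
  simp [matrixOperator_apply, Finset.sum_add_distrib]

theorem matrixOperator_smul {n : ℕ} (c : ℂ) (X : Matrix (Fin n) (Fin n) (H →L[ℂ] H)) :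
    matrixOperator (c • X) = c • matrixOperator X := by
  ext ξ i
  simp [matrixOperator_apply, Finset.smul_sum]

theorem norm_entry_le_matrixOperator {n : ℕ} (X : Matrix (Fin n) (Fin n) (H →L[ℂ] H))
    (i j : Fin n) : ‖X i j‖ ≤ ‖matrixOperator X‖ := by
  refine ContinuousLinearMap.opNorm_le_bound _ (ContinuousLinearMap.opNorm_nonneg _) fun v => ?_
  have h1 := (matrixOperator X).le_opNorm (PiLp.single 2 j v)
  have h2 := PiLp.norm_apply_le (matrixOperator X (PiLp.single 2 j v)) i
  rw [matrixOperator_apply, Finset.sum_eq_single j] at h2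
  · simp only [PiLp.norm_single] at h1
    simpa using h2.trans h1
  · intro k _ hk
    simp [hk]
  · simp

theorem norm_matrixOperator_le_sum {n : ℕ} (X : Matrix (Fin n) (Fin n) (H →L[ℂ] H)) :
    ‖matrixOperator X‖ ≤ ∑ i, ∑ j, ‖X i j‖ := by
  refine ContinuousLinearMap.opNorm_le_bound _
    (Finset.sum_nonneg fun i _ => Finset.sum_nonneg fun j _ => norm_nonneg _) fun ξ => ?_
  have h1 : ‖matrixOperator X ξ‖ ≤ ∑ i, ‖matrixOperator X ξ i‖ := by
    rw [PiLp.norm_eq_of_L2]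
    exact Real.sqrt_le_iff.2 ⟨Finset.sum_nonneg fun i _ => norm_nonneg _,
      Finset.sum_sq_le_sq_sum_of_nonneg fun i _ => norm_nonneg _⟩
  refine h1.trans ?_
  rw [Finset.sum_mul]
  refine Finset.sum_le_sum fun i _ => ?_
  rw [matrixOperator_apply, Finset.sum_mul]
  refine (norm_sum_le _ _).trans (Finset.sum_le_sum fun j _ => ?_)
  exact ((X i j).le_opNorm _).trans
    (mul_le_mul_of_nonneg_left (PiLp.norm_apply_le ξ j) (norm_nonneg _))

theorem norm_matrixOperator_diagonal_le {n : ℕ} (T : H →L[ℂ] H) :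
    ‖matrixOperator (Matrix.diagonal fun _ : Fin n => T)‖ ≤ ‖T‖ := by
  refine ContinuousLinearMap.opNorm_le_bound _ (norm_nonneg _) fun ξ => ?_
  have h1 : ∀ i, matrixOperator (Matrix.diagonal fun _ : Fin n => T) ξ i = T (ξ i) := fun i => by
    rw [matrixOperator_apply, Finset.sum_eq_single i]
    · simp
    · intro j _ hj
      simp [Matrix.diagonal_apply_ne' _ hj]
    · simp
  refine le_of_sq_le_sq ?_ (by positivity)
  rw [mul_pow, PiLp.norm_sq_eq_of_L2, PiLp.norm_sq_eq_of_L2, Finset.mul_sum]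
  refine Finset.sum_le_sum fun i _ => ?_
  rw [h1, ← mul_pow]
  exact pow_le_pow_left₀ (norm_nonneg _) (T.le_opNorm _) 2

end Hilbert

/-! ### Matrix norms of algebras with a completely isometric representation -/

section Concrete

variable {H : Type*} [NormedAddCommGroup H] [InnerProductSpace ℂ H]
  {V : Type*} [NonUnitalNormedRing V] [NormedSpace ℂ V] [MatrixNorms V]
  {ι : V →ₙₐ[ℂ] (H →L[ℂ] H)}

theorem IsCompleteIsometry.matNorm_eq (hι : IsCompleteIsometry ι) {n : ℕ}
    (X : Matrix (Fin n) (Fin n) V) : MatrixNorms.matNorm X = ‖matrixOperator (X.map ι)‖ :=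
  (hι n X).symm

theorem IsCompleteIsometry.norm_map {V W : Type*} [NonUnitalNormedRing V] [NormedSpace ℂ V]
    [MatrixNorms V] [NonUnitalNormedRing W] [MatrixNorms W] [LawfulMatrixNorms V]
    [LawfulMatrixNorms W] {f : V → W} (hf : IsCompleteIsometry f) (x : V) : ‖f x‖ = ‖x‖ := by
  rw [← LawfulMatrixNorms.matNorm_one, ← LawfulMatrixNorms.matNorm_one,
    ← hf 1 (Matrix.of fun _ _ => x)]
  rfl

theorem IsCompleteIsometry.matNorm_nonneg (hι : IsCompleteIsometry ι) {n : ℕ}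
    (X : Matrix (Fin n) (Fin n) V) : 0 ≤ MatrixNorms.matNorm X := by
  rw [hι.matNorm_eq]
  exact ContinuousLinearMap.opNorm_nonneg _

theorem IsCompleteIsometry.matNorm_add_le (hι : IsCompleteIsometry ι) {n : ℕ}
    (X Y : Matrix (Fin n) (Fin n) V) :
    MatrixNorms.matNorm (X + Y) ≤ MatrixNorms.matNorm X + MatrixNorms.matNorm Y := by
  rw [hι.matNorm_eq, hι.matNorm_eq, hι.matNorm_eq, Matrix.map_add _ (map_add ι),
    matrixOperator_add]
  exact ContinuousLinearMap.opNorm_add_le _ _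

theorem IsCompleteIsometry.matNorm_smul_le (hι : IsCompleteIsometry ι) {n : ℕ} (c : ℂ)
    (X : Matrix (Fin n) (Fin n) V) :
    MatrixNorms.matNorm (c • X) ≤ ‖c‖ * MatrixNorms.matNorm X := by
  rw [hι.matNorm_eq, hι.matNorm_eq, Matrix.map_smul ι c (fun a => map_smul ι c a),
    matrixOperator_smul]
  exact ContinuousLinearMap.opNorm_smul_le _ _

theorem norm_matrixOperator_mul_le {n : ℕ} (X Y : Matrix (Fin n) (Fin n) (H →L[ℂ] H)) :
    ‖matrixOperator (X * Y)‖ ≤ ‖matrixOperator X‖ * ‖matrixOperator Y‖ := by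
  rw [matrixOperator_mul]
  exact ContinuousLinearMap.opNorm_comp_le _ _

theorem IsCompleteIsometry.matNorm_mul_le (hι : IsCompleteIsometry ι) {n : ℕ}
    (X Y : Matrix (Fin n) (Fin n) V) :
    MatrixNorms.matNorm (X * Y) ≤ MatrixNorms.matNorm X * MatrixNorms.matNorm Y := by
  rw [hι.matNorm_eq, hι.matNorm_eq, hι.matNorm_eq, Matrix.map_mul]
  exact norm_matrixOperator_mul_le _ _

theorem IsCompleteIsometry.matNorm_diagonal_le [LawfulMatrixNorms V] (hι : IsCompleteIsometry ι)
    (n : ℕ) (v : V) : MatrixNorms.matNorm (Matrix.diagonal fun _ : Fin n => v) ≤ ‖v‖ := by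
  rw [hι.matNorm_eq, Matrix.diagonal_map (map_zero ι), ← hι.norm_map]
  exact norm_matrixOperator_diagonal_le _

theorem IsCompleteIsometry.norm_entry_le [LawfulMatrixNorms V] (hι : IsCompleteIsometry ι) {n : ℕ}
    (X : Matrix (Fin n) (Fin n) V) (i j : Fin n) : ‖X i j‖ ≤ MatrixNorms.matNorm X := by
  rw [hι.matNorm_eq, ← hι.norm_map]
  exact norm_entry_le_matrixOperator (X.map ι) i j

theorem IsCompleteIsometry.matNorm_le_sum [LawfulMatrixNorms V] (hι : IsCompleteIsometry ι) {n : ℕ}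
    (X : Matrix (Fin n) (Fin n) V) : MatrixNorms.matNorm X ≤ ∑ i, ∑ j, ‖X i j‖ := by
  rw [hι.matNorm_eq]
  simp only [← hι.norm_map]
  exact norm_matrixOperator_le_sum (X.map ι)

theorem IsCompleteIsometry.matNorm_zero [LawfulMatrixNorms V] (hι : IsCompleteIsometry ι) (n : ℕ) :
    MatrixNorms.matNorm (0 : Matrix (Fin n) (Fin n) V) = 0 :=
  le_antisymm (by simpa using hι.matNorm_le_sum (0 : Matrix (Fin n) (Fin n) V))
    (hι.matNorm_nonneg _)

/-- The matrix size is fixed, so the norm is bounded by a finite sum of entry norms. This turns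
pointwise approximate unit statements into statements about matrices. -/
theorem IsCompleteIsometry.tendsto_matNorm_zero [LawfulMatrixNorms V] (hι : IsCompleteIsometry ι)
    {n : ℕ} {κ : Type*} {l : Filter κ} {X : κ → Matrix (Fin n) (Fin n) V}
    (h : ∀ i j, Tendsto (fun t => X t i j) l (𝓝 0)) :
    Tendsto (fun t => MatrixNorms.matNorm (X t)) l (𝓝 0) := by
  refine squeeze_zero (fun t => hι.matNorm_nonneg _) (fun t => hι.matNorm_le_sum _) ?_
  have : Tendsto (fun t => ∑ i, ∑ j, ‖X t i j‖) l (𝓝 (∑ i : Fin n, ∑ j : Fin n, (0 : ℝ))) :=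
    tendsto_finsetSum _ fun i _ => tendsto_finsetSum _ fun j _ => by simpa using (h i j).norm
  simpa using this

variable [CompleteSpace H] [LawfulMatrixNorms V]

/-- The unit exists only in the representing algebra, so the amplified bound is formulated there;
the two lemmas below bring it back to `V`. -/
theorem IsRegularized.norm_matrixOperator_diagonal_le (hι : IsCompleteIsometry ι) {δ : ℝ}
    (hδ : 0 < δ) {f : V} (hf : IsRegularized δ f) (n : ℕ) :
    ‖matrixOperator (1 - Matrix.diagonal fun _ => ι f : Matrix (Fin n) (Fin n) (H →L[ℂ] H))‖ ≤ 1 + δ := by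
  rw [← Matrix.diagonal_one, Matrix.diagonal_sub]
  exact (OpAlg.norm_matrixOperator_diagonal_le _).trans
    ((hf.map fun v => (hι.norm_map v).le).norm_one_sub_le hδ)

theorem IsRegularized.matNorm_sub_left_le (hι : IsCompleteIsometry ι) {δ : ℝ} (hδ : 0 < δ)
    {f : V} (hf : IsRegularized δ f) {n : ℕ} (X : Matrix (Fin n) (Fin n) V) :
    MatrixNorms.matNorm (X - (Matrix.diagonal fun _ => f) * X) ≤
      (1 + δ) * MatrixNorms.matNorm X := by
  have h1 : (X - (Matrix.diagonal fun _ => f) * X).map ι =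
      (1 - Matrix.diagonal fun _ => ι f) * X.map ι := by
    rw [Matrix.map_sub _ (map_sub ι), Matrix.map_mul, Matrix.diagonal_map (map_zero ι), sub_mul,
      one_mul]
  rw [hι.matNorm_eq, h1, hι.matNorm_eq]
  exact (norm_matrixOperator_mul_le _ _).trans (mul_le_mul_of_nonneg_right
    (hf.norm_matrixOperator_diagonal_le hι hδ n) (ContinuousLinearMap.opNorm_nonneg _))

theorem IsRegularized.matNorm_sub_right_le (hι : IsCompleteIsometry ι) {δ : ℝ} (hδ : 0 < δ)
    {f : V} (hf : IsRegularized δ f) {n : ℕ} (X : Matrix (Fin n) (Fin n) V) :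
    MatrixNorms.matNorm (X - X * (Matrix.diagonal fun _ => f)) ≤
      (1 + δ) * MatrixNorms.matNorm X := by
  have h1 : (X - X * (Matrix.diagonal fun _ => f)).map ι =
      X.map ι * (1 - Matrix.diagonal fun _ => ι f) := by
    rw [Matrix.map_sub _ (map_sub ι), Matrix.map_mul, Matrix.diagonal_map (map_zero ι), mul_sub,
      mul_one]
  rw [hι.matNorm_eq, h1, hι.matNorm_eq, mul_comm]
  exact (norm_matrixOperator_mul_le _ _).trans (mul_le_mul_of_nonneg_left
    (hf.norm_matrixOperator_diagonal_le hι hδ n) (ContinuousLinearMap.opNorm_nonneg _))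

end Concrete

theorem isCompleteIsometry_subtype {V : Type*} [NonUnitalNormedRing V] [NormedSpace ℂ V]
    [MatrixNorms V] (S : NonUnitalSubalgebra ℂ V) :
    IsCompleteIsometry (NonUnitalSubalgebraClass.subtype S) := fun _ _ => rfl

theorem IsCompleteIsometry.comp {U V W : Type*} [MatrixNorms U] [MatrixNorms V] [MatrixNorms W]
    {g : V → W} {f : U → V} (hg : IsCompleteIsometry g) (hf : IsCompleteIsometry f) :
    IsCompleteIsometry (g ∘ f) := fun n X => by
  rw [← hf, ← hg, Matrix.map_map]

/-! ### The multiplier algebra norms -/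

section Multiplier

variable {H : Type*} [NormedAddCommGroup H] [InnerProductSpace ℂ H]
  {V : Type*} [NonUnitalNormedRing V] [NormedSpace ℂ V] [IsScalarTower ℂ V V] [SMulCommClass ℂ V V]
  [MatrixNorms V] [LawfulMatrixNorms V] {ι : V →ₙₐ[ℂ] (H →L[ℂ] H)}

/-- The left action of a matrix of multipliers. -/
noncomputable def matrixAct {n : ℕ} (X : Matrix (Fin n) (Fin n) 𝓜(ℂ, V)) (c : Matrix (Fin n) (Fin n) V) :
    Matrix (Fin n) (Fin n) V := Matrix.of fun i j => ∑ k, (X i k).fst (c k j)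

theorem matrixAct_smul {n : ℕ} (X : Matrix (Fin n) (Fin n) 𝓜(ℂ, V)) (r : ℂ)
    (c : Matrix (Fin n) (Fin n) V) : matrixAct X (r • c) = r • matrixAct X c := by
  ext i j
  simp [matrixAct, Finset.smul_sum]

theorem matrixAct_zero {n : ℕ} (X : Matrix (Fin n) (Fin n) 𝓜(ℂ, V)) : matrixAct X 0 = 0 := by
  ext i j
  simp [matrixAct]

/-- Needed because the norm of a multiplier matrix is a real `sSup`, which would be 0 on an
unbounded set. -/
theorem bddAbove_matrixAct (hι : IsCompleteIsometry ι) {n : ℕ}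
    (X : Matrix (Fin n) (Fin n) 𝓜(ℂ, V)) :
    BddAbove {r : ℝ | ∃ a : Matrix (Fin n) (Fin n) V, MatrixNorms.matNorm a ≤ 1 ∧
      r = MatrixNorms.matNorm (matrixAct X a)} := by
  refine ⟨∑ i, ∑ _j : Fin n, ∑ k, ‖(X i k).fst‖, ?_⟩
  rintro _ ⟨a, ha, rfl⟩
  refine (hι.matNorm_le_sum _).trans (Finset.sum_le_sum fun i _ => Finset.sum_le_sum fun j _ => ?_)
  rw [matrixAct, Matrix.of_apply]
  refine (norm_sum_le _ _).trans (Finset.sum_le_sum fun k _ => ?_)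
  exact ((X i k).fst.le_opNorm _).trans
    (mul_le_of_le_one_right (norm_nonneg _) ((hι.norm_entry_le a k j).trans ha))

theorem matNorm_multiplier_le (hι : IsCompleteIsometry ι) {n : ℕ}
    {X : Matrix (Fin n) (Fin n) 𝓜(ℂ, V)} {M : ℝ}
    (h : ∀ a, MatrixNorms.matNorm a ≤ 1 → MatrixNorms.matNorm (matrixAct X a) ≤ M) :
    MatrixNorms.matNorm X ≤ M := by
  refine csSup_le ⟨_, 0, by rw [hι.matNorm_zero]; exact zero_le_one, rfl⟩ ?_
  rintro _ ⟨a, ha, rfl⟩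
  exact h a ha

theorem matNorm_multiplier_nonneg (hι : IsCompleteIsometry ι) {n : ℕ}
    (X : Matrix (Fin n) (Fin n) 𝓜(ℂ, V)) : 0 ≤ MatrixNorms.matNorm X := by
  refine Real.sSup_nonneg ?_
  rintro _ ⟨a, -, rfl⟩
  exact hι.matNorm_nonneg _

theorem matNorm_matrixAct_le (hι : IsCompleteIsometry ι) {n : ℕ}
    (X : Matrix (Fin n) (Fin n) 𝓜(ℂ, V)) (c : Matrix (Fin n) (Fin n) V) :
    MatrixNorms.matNorm (matrixAct X c) ≤ MatrixNorms.matNorm X * MatrixNorms.matNorm c := by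
  have hone : ∀ a : Matrix (Fin n) (Fin n) V, MatrixNorms.matNorm a ≤ 1 →
      MatrixNorms.matNorm (matrixAct X a) ≤ MatrixNorms.matNorm X := fun a ha =>
    le_csSup (bddAbove_matrixAct hι X) ⟨a, ha, rfl⟩
  rcases (hι.matNorm_nonneg c).eq_or_lt with h0 | hpos
  · have : c = 0 := by
      ext i j
      exact norm_le_zero_iff.1 ((hι.norm_entry_le c i j).trans h0.symm.le)
    rw [this, matrixAct_zero, hι.matNorm_zero, mul_zero]
  · set m := MatrixNorms.matNorm c
    have hm : ((m : ℝ) : ℂ) ≠ 0 := by exact_mod_cast hpos.ne'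
    have h1 := hone ((m : ℂ)⁻¹ • c) ((hι.matNorm_smul_le _ _).trans (by
      rw [norm_inv, Complex.norm_of_nonneg hpos.le, inv_mul_cancel₀ hpos.ne']))
    have h2 := hι.matNorm_smul_le (m : ℂ) (matrixAct X ((m : ℂ)⁻¹ • c))
    rw [← matrixAct_smul, smul_smul, mul_inv_cancel₀ hm, one_smul, Complex.norm_of_nonneg hpos.le,
      mul_comm] at h2
    exact h2.trans (mul_le_mul_of_nonneg_right h1 hpos.le)

end Multiplier

/-! ### The canonical map of corona algebras is completely isometric -/

section CoronaInclusion

variable {V : Type*} [NonUnitalNormedRing V] [NormedSpace ℂ V] [IsScalarTower ℂ V V]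
  [SMulCommClass ℂ V V] {A : NonUnitalSubalgebra ℂ V}

theorem ContainsCai.mem_of_forall_mul_mem (h : ContainsCai A) (hA : IsClosed (A : Set V)) {d : V}
    (hd : ∀ a ∈ A, d * a ∈ A) : d ∈ A := by
  obtain ⟨l, hl, -⟩ := h
  have : l.NeBot := map_neBot_iff _ |>.1 hl.neBot
  exact hA.mem_of_tendsto (tendsto_map'_iff.1 (hl.tendsto_mul_left d))
    (Eventually.of_forall fun e => hd e e.2)

/-- If the extension of `T` is multiplication by some `d` in `V`, then `dA ⊆ A`; the cai in `A` and
closedness put `d` in `A`, so `T` was already zero in the corona of `A`. -/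
theorem coronaInclusion_injective (hV : CompleteSpace V) (h : ContainsCai A) (hV' : ApproxUnital V)
    (hA : IsClosed (A : Set V)) : Function.Injective (coronaInclusion hV h hV') := by
  refine (injective_iff_map_eq_zero _).2 fun y hy => ?_
  obtain ⟨T, rfl⟩ := Ideal.Quotient.mk_surjective y
  rw [coronaInclusion_mk, Ideal.Quotient.eq_zero_iff_mem] at hy
  obtain ⟨d, hd⟩ := hy
  have h1 : ∀ a : A, (T.fst a : V) = d * a ∧ (T.snd a : V) = a * d := fun a => by
    rw [← multiplierExtension_fst hV h, ← multiplierExtension_snd hV h, ← hd]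
    simp
  have hdA : d ∈ A := h.mem_of_forall_mul_mem hA fun a ha => by
    rw [← (h1 ⟨a, ha⟩).1]
    exact (T.fst _).2
  refine Ideal.Quotient.eq_zero_iff_mem.2 ⟨⟨d, hdA⟩, ?_⟩
  ext a
  · simp [(h1 a).1]
  · simp [(h1 a).2]

variable [MatrixNorms V] [LawfulMatrixNorms V]
  {H : Type*} [NormedAddCommGroup H] [InnerProductSpace ℂ H] {ι : V →ₙₐ[ℂ] (H →L[ℂ] H)}

/-- Extending multipliers does not increase the matrix norms. -/
theorem matNorm_multiplierExtension_le (hι : IsCompleteIsometry ι) (hV : CompleteSpace V)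
    (h : ContainsCai A) {n : ℕ} (X : Matrix (Fin n) (Fin n) 𝓜(ℂ, A)) :
    MatrixNorms.matNorm (X.map (multiplierExtension hV h)) ≤ MatrixNorms.matNorm X := by
  have hιA : IsCompleteIsometry (ι.comp (NonUnitalSubalgebraClass.subtype A)) :=
    hι.comp (isCompleteIsometry_subtype A)
  have hcai := h
  obtain ⟨l, hl, h1⟩ := h
  have : l.NeBot := map_neBot_iff _ |>.1 hl.neBot
  set X' := X.map (multiplierExtension hV hcai)
  have hVu : ApproxUnital V := ⟨_, hl, h1⟩
  refine matNorm_multiplier_le hι fun c hc => ?_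
  have key : ∀ e : A, ‖e‖ ≤ 1 → MatrixNorms.matNorm
      (matrixAct X' ((Matrix.diagonal fun _ => (e : V)) * c)) ≤ MatrixNorms.matNorm X := by
    intro e he
    -- Module property: `X'(ec) = (Xe)c`. The extended multiplier is applied only to `e ∈ A`, where
    -- it is `X`, and `c` enters as a right factor of norm at most 1.
    have h2 : matrixAct X' ((Matrix.diagonal fun _ => (e : V)) * c) =
        (matrixAct X (Matrix.diagonal fun _ => e)).map (fun x : A => (x : V)) * c := by
      ext i j
      have h3 : ∀ k, ((Matrix.diagonal fun _ => (e : V)) * c : Matrix (Fin n) (Fin n) V) k j =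
          e * c k j := fun k => Matrix.diagonal_mul _ _ _ _
      have h4 : ∀ k, matrixAct X (Matrix.diagonal fun _ => e) i k = (X i k).fst e := fun k => by
        rw [matrixAct, Matrix.of_apply, Finset.sum_eq_single k, Matrix.diagonal_apply_eq]
        · intro m _ hm
          rw [Matrix.diagonal_apply_ne _ hm, map_zero]
        · simp
      rw [matrixAct, Matrix.of_apply, Matrix.mul_apply]
      refine Finset.sum_congr rfl fun k _ => ?_
      rw [h3, hVu.fst_mul, Matrix.map_apply, h4]
      exact congrArg (· * c k j) (multiplierExtension_fst hV hcai _ _)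
    rw [h2]
    refine (hι.matNorm_mul_le _ _).trans ?_
    refine (mul_le_of_le_one_right (hι.matNorm_nonneg _) hc).trans ?_
    refine (matNorm_matrixAct_le hιA X (Matrix.diagonal fun _ => e)).trans ?_
    exact mul_le_of_le_one_right (matNorm_multiplier_nonneg hιA X)
      ((hιA.matNorm_diagonal_le n e).trans he)
  have hlim : Tendsto (fun e : A => MatrixNorms.matNorm
      (matrixAct X' (c - (Matrix.diagonal fun _ => (e : V)) * c))) l (𝓝 0) := by
    refine hι.tendsto_matNorm_zero fun i j => ?_
    have : Tendsto (fun e : A => ∑ k, (X' i k).fst (c k j - (e : V) * c k j)) l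
        (𝓝 (∑ k : Fin n, (0 : V))) := by
      refine tendsto_finsetSum _ fun k _ => ?_
      have h3 : Tendsto (fun e : A => c k j - (e : V) * c k j) l (𝓝 (c k j - c k j)) :=
        (tendsto_map'_iff.1 (hl.tendsto_mul_right (c k j))).const_sub _
      rw [sub_self] at h3
      have := ((X' i k).fst.continuous.tendsto 0).comp h3
      rwa [map_zero] at this
    simpa [matrixAct, Matrix.diagonal_mul] using this
  have hlim2 := hlim.const_add (MatrixNorms.matNorm X)
  rw [add_zero] at hlim2
  refine ge_of_tendsto hlim2 ?_
  filter_upwards [h1] with e he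
  have h4 : matrixAct X' c = matrixAct X' ((Matrix.diagonal fun _ => (e : V)) * c) +
      matrixAct X' (c - (Matrix.diagonal fun _ => (e : V)) * c) := by
    ext i j
    simp [matrixAct]
  rw [h4]
  exact (hι.matNorm_add_le _ _).trans (add_le_add_left (key e he) _)

/-- Modulo `A`, the norm of a matrix of multipliers of `A` is at most the norm of its image modulo
`V`. -/
theorem exists_matNorm_le_of_coronaInclusion [CompleteSpace H] (hι : IsCompleteIsometry ι)
    (hV : CompleteSpace V) (h : ContainsCai A) (hV' : ApproxUnital V) (hA : IsClosed (A : Set V))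
    {n : ℕ} (T : Matrix (Fin n) (Fin n) 𝓜(ℂ, A)) (X' : Matrix (Fin n) (Fin n) 𝓜(ℂ, V))
    (hX : ∀ i j, Ideal.Quotient.mk (coronaIdeal V hV') (X' i j) =
      Ideal.Quotient.mk (coronaIdeal V hV') (multiplierExtension hV h (T i j))) {δ : ℝ}
    (hδ : 0 < δ) :
    ∃ X : Matrix (Fin n) (Fin n) 𝓜(ℂ, A),
      (∀ i j, Ideal.Quotient.mk (coronaIdeal A h.approxUnital) (X i j) =
        Ideal.Quotient.mk (coronaIdeal A h.approxUnital) (T i j)) ∧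
      MatrixNorms.matNorm X ≤ (1 + δ) * MatrixNorms.matNorm X' + δ := by
  have hιA : IsCompleteIsometry (ι.comp (NonUnitalSubalgebraClass.subtype A)) :=
    hι.comp (isCompleteIsometry_subtype A)
  have hAc : CompleteSpace A := hA.completeSpace_coe
  obtain ⟨l, hl, h1⟩ := h.exists_regularized hAc hδ
  have : l.NeBot := map_neBot_iff _ |>.1 hl.neBot
  choose d hd using fun i j => Ideal.Quotient.eq.1 (hX i j).symm
  replace hd : ∀ i j (a : A), ((T i j).fst a : V) = (X' i j).fst a + d i j * a := fun i j a => by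
    rw [← multiplierExtension_fst hV h, ← sub_eq_iff_eq_add']
    have := congrArg (fun S : 𝓜(ℂ, V) => S.fst (a : V)) (hd i j)
    simpa using this.symm
  let d' : Matrix (Fin n) (Fin n) V := Matrix.of d
  have hlim : Tendsto (fun f : A => MatrixNorms.matNorm
      (d' - d' * Matrix.diagonal fun _ => (f : V))) l (𝓝 0) := by
    refine hι.tendsto_matNorm_zero fun i j => ?_
    have h3 : Tendsto (fun e : A => d i j - d i j * (e : V)) l (𝓝 (d i j - d i j)) :=
      (tendsto_map'_iff.1 (hl.tendsto_mul_left (d i j))).const_sub _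
    rw [sub_self] at h3
    simpa [d', Matrix.mul_diagonal] using h3
  obtain ⟨f, ⟨hf1, hf⟩, hfd⟩ := (h1.and (hlim.eventually_le_const hδ)).exists
  -- This is `T(1 - f)`: the subtracted entries `T f` lie in `A`, so the class modulo `A` is that of
  -- `T`.
  refine ⟨Matrix.of fun i j => T i j - DoubleCentralizer.coe ℂ ((T i j).fst f), fun i j => ?_, ?_⟩
  · rw [Matrix.of_apply, Ideal.Quotient.eq, sub_sub_cancel_left]
    exact neg_mem ⟨_, rfl⟩
  refine matNorm_multiplier_le hιA fun c hc => ?_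
  set c' : Matrix (Fin n) (Fin n) A := c - (Matrix.diagonal fun _ => f) * c
  set c'' : Matrix (Fin n) (Fin n) V := c'.map (fun x : A => (x : V))
  set c₀ : Matrix (Fin n) (Fin n) V := c.map (fun x : A => (x : V))
  have hc' : MatrixNorms.matNorm c'' ≤ 1 + δ :=
    (hf.matNorm_sub_left_le hιA hδ c).trans (mul_le_of_le_one_right (by positivity) hc)
  -- On `A` one has `T = X' + d'`, hence `T(1 - f)c = X'((1 - f)c) + d'(1 - f)c`. The first term
  -- costs the factor `1 + δ`, the second at most `δ` by the choice of `f`.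
  have h5 : (matrixAct (Matrix.of fun i j => T i j - DoubleCentralizer.coe ℂ ((T i j).fst f))
      c).map (fun x : A => (x : V)) =
      matrixAct X' c'' + (d' - d' * Matrix.diagonal fun _ => (f : V)) * c₀ := by
    have h6 : d' * c'' = (d' - d' * Matrix.diagonal fun _ => (f : V)) * c₀ := by
      have : c'' = c₀ - (Matrix.diagonal fun _ => (f : V)) * c₀ := by
        ext i j
        simp [c'', c', c₀, Matrix.diagonal_mul]
      rw [this, sub_mul, mul_sub, mul_assoc]
    rw [← h6]
    ext i j
    simp only [matrixAct, Matrix.map_apply, Matrix.of_apply, Matrix.add_apply, Matrix.mul_apply,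
      ← Finset.sum_add_distrib]
    rw [AddSubmonoidClass.coe_finsetSum]
    refine Finset.sum_congr rfl fun k _ => ?_
    change _ = (X' i k).fst (c' k j : V) + d i k * (c' k j : V)
    rw [← hd]
    congr 1
    simp [c', Matrix.diagonal_mul, h.approxUnital.fst_mul]
  change MatrixNorms.matNorm (Matrix.map _ (fun x : A => (x : V))) ≤ _
  rw [h5]
  refine (hι.matNorm_add_le _ _).trans (add_le_add ?_ ?_)
  · refine (matNorm_matrixAct_le hι _ _).trans ?_
    rw [mul_comm]
    exact mul_le_mul_of_nonneg_right hc' (matNorm_multiplier_nonneg hι _)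
  · refine (hι.matNorm_mul_le _ _).trans ?_
    exact (mul_le_of_le_one_right (hι.matNorm_nonneg _) hc).trans hfd

theorem matNorm_corona_le (hι : IsCompleteIsometry ι) (hV : ApproxUnital V) {n : ℕ}
    (X : Matrix (Fin n) (Fin n) 𝓜(ℂ, V)) :
    MatrixNorms.matNorm (X.map (Ideal.Quotient.mk (coronaIdeal V hV))) ≤
      MatrixNorms.matNorm X := by
  refine csInf_le ⟨0, ?_⟩ ⟨X, rfl, rfl⟩
  rintro _ ⟨Z, -, rfl⟩
  exact matNorm_multiplier_nonneg hι Z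

theorem le_matNorm_corona (hV : ApproxUnital V) {n : ℕ}
    (Y : Matrix (Fin n) (Fin n) (Corona V hV)) {M : ℝ}
    (h : ∀ X : Matrix (Fin n) (Fin n) 𝓜(ℂ, V),
      X.map (Ideal.Quotient.mk (coronaIdeal V hV)) = Y → M ≤ MatrixNorms.matNorm X) :
    M ≤ MatrixNorms.matNorm Y := by
  choose T hT using fun i j => Ideal.Quotient.mk_surjective (Y i j)
  refine le_csInf ⟨_, Matrix.of T, Matrix.ext hT, rfl⟩ ?_
  rintro _ ⟨X, hX, rfl⟩
  exact h X hX

/-- One inequality holds because extending a multiplier does not raise its norm; for the other, any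
lift over `V` is replaced by a lift over `A` at the cost of `δ`, and `δ → 0`. -/
theorem isCompleteIsometry_coronaInclusion [CompleteSpace H] (hι : IsCompleteIsometry ι)
    (hV : CompleteSpace V) (h : ContainsCai A) (hV' : ApproxUnital V)
    (hA : IsClosed (A : Set V)) : IsCompleteIsometry (coronaInclusion hV h hV') := by
  have hιA : IsCompleteIsometry (ι.comp (NonUnitalSubalgebraClass.subtype A)) :=
    hι.comp (isCompleteIsometry_subtype A)
  intro n Y
  choose T hT using fun i j => Ideal.Quotient.mk_surjective (Y i j)
  have hTY : (Matrix.of T).map (Ideal.Quotient.mk (coronaIdeal A h.approxUnital)) = Y := by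
    ext i j
    exact hT i j
  have hlift : ∀ X : Matrix (Fin n) (Fin n) 𝓜(ℂ, A),
      X.map (Ideal.Quotient.mk (coronaIdeal A h.approxUnital)) = Y →
      (X.map (multiplierExtension hV h)).map (Ideal.Quotient.mk (coronaIdeal V hV')) =
        Y.map (coronaInclusion hV h hV') := by
    rintro X rfl
    rfl
  apply le_antisymm
  · refine le_matNorm_corona _ _ fun X hX => ?_
    rw [← hlift X hX]
    exact (matNorm_corona_le hι hV' _).trans (matNorm_multiplierExtension_le hι hV h X)
  · refine le_matNorm_corona _ _ fun X' hX' => ?_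
    have hlim : Tendsto (fun δ : ℝ => (1 + δ) * MatrixNorms.matNorm X' + δ) (𝓝[>] 0)
        (𝓝 (MatrixNorms.matNorm X')) := by
      have : Continuous fun δ : ℝ => (1 + δ) * MatrixNorms.matNorm X' + δ := by fun_prop
      simpa using (this.tendsto 0).mono_left nhdsWithin_le_nhds
    refine ge_of_tendsto hlim ?_
    filter_upwards [self_mem_nhdsWithin] with δ hδ
    obtain ⟨X, hX, hle⟩ := exists_matNorm_le_of_coronaInclusion hι hV h hV' hA (Matrix.of T) X'
      (fun i j => by
        have := congrFun (congrFun (hX'.trans (hlift _ hTY).symm) i) j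
        exact this) hδ
    have hXY : X.map (Ideal.Quotient.mk (coronaIdeal A h.approxUnital)) = Y :=
      (Matrix.ext hX).trans hTY
    rw [← hXY]
    exact (matNorm_corona_le hιA h.approxUnital X).trans hle

end CoronaInclusion

/-! ### Approximate identities of extensions -/

section NearUnit

variable {H : Type*} [NormedAddCommGroup H] [InnerProductSpace ℂ H] [CompleteSpace H]

/-- For a contraction, `‖e*v - v‖² ≤ 2‖v‖² - 2 Re ⟨v, ev⟩ = -2 Re ⟨v, ev - v⟩`. So the adjoints of a
cai are also approximate units, although they need not lie in the algebra. -/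
theorem norm_star_mul_sub_sq_le {e : H →L[ℂ] H} (he : ‖e‖ ≤ 1) (s : H →L[ℂ] H) :
    ‖star e * s - s‖ ^ 2 ≤ 2 * ‖s‖ * ‖e * s - s‖ := by
  have h0 : 0 ≤ 2 * ‖s‖ * ‖e * s - s‖ := by positivity
  refine Real.le_sqrt (norm_nonneg _) h0 |>.1 ?_
  refine ContinuousLinearMap.opNorm_le_bound _ (Real.sqrt_nonneg _) fun ξ => ?_
  refine le_of_sq_le_sq ?_ (by positivity)
  rw [mul_pow, Real.sq_sqrt h0]
  set v := s ξ
  have hv : ‖v‖ ≤ ‖s‖ * ‖ξ‖ := s.le_opNorm ξ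
  have hw : ‖e v - v‖ ≤ ‖e * s - s‖ * ‖ξ‖ := (e * s - s).le_opNorm ξ
  have h1 : ‖(star e) v‖ ≤ ‖v‖ := by
    refine ((star e).le_opNorm v).trans (mul_le_of_le_one_left (norm_nonneg _) ?_)
    rwa [norm_star]
  have h2 := norm_sub_sq (𝕜 := ℂ) ((star e) v) v
  have h3 : inner ℂ ((star e) v) v = inner ℂ v (e v) :=
    ContinuousLinearMap.adjoint_inner_left e v v
  rw [h3] at h2
  have h4 : RCLike.re (inner ℂ v (e v)) = ‖v‖ ^ 2 + RCLike.re (inner ℂ v (e v - v)) := by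
    rw [inner_sub_right, map_sub, inner_self_eq_norm_sq (𝕜 := ℂ)]
    ring
  have h5 : -(‖v‖ * ‖e v - v‖) ≤ RCLike.re (inner ℂ v (e v - v)) := by
    have := (abs_le.1 ((RCLike.abs_re_le_norm _).trans (norm_inner_le_norm (𝕜 := ℂ) v (e v - v)))).1
    exact this
  have h6 : ‖v‖ * ‖e v - v‖ ≤ (‖s‖ * ‖ξ‖) * (‖e * s - s‖ * ‖ξ‖) :=
    mul_le_mul hv hw (norm_nonneg _) (by positivity)
  have h7 : ‖(star e) v‖ ^ 2 ≤ ‖v‖ ^ 2 := pow_le_pow_left₀ (norm_nonneg _) h1 2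
  change ‖(star e) v - v‖ ^ 2 ≤ _
  rw [h2, h4]
  nlinarith

/-- The sum of two operators with almost orthogonal ranges and almost orthogonal initial spaces. -/
theorem norm_add_sq_le_of_almost_orthogonal {p r : H →L[ℂ] H} {M η : ℝ}
    (hp : ‖p‖ ≤ M) (hr : ‖r‖ ≤ M) (h1 : ‖star p * r‖ ≤ η) (h2 : ‖r * star p‖ ≤ η) :
    ‖p + r‖ ^ 2 ≤ M ^ 2 + 3 * η := by
  have hη : 0 ≤ η := (norm_nonneg _).trans h1
  have hM : 0 ≤ M := (norm_nonneg _).trans hp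
  have h0 : 0 ≤ M ^ 2 + 3 * η := by positivity
  refine Real.le_sqrt (norm_nonneg _) h0 |>.1 ?_
  refine ContinuousLinearMap.opNorm_le_bound _ (Real.sqrt_nonneg _) fun ξ => ?_
  refine le_of_sq_le_sq ?_ (by positivity)
  rw [mul_pow, Real.sq_sqrt h0, add_apply]
  set u := p ξ with hu
  set v := r ξ with hv
  -- Since `S = Re ⟨ξ, p*u + r*v⟩`, a bound of `‖p*u + r*v‖²` by `(M² + η)S` gives `S² ≤ (M² +
  -- η)S‖ξ‖²`, and one factor `S` cancels. The cross term of `‖u + v‖²` adds `2η`, whence `3η`.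
  set S := ‖u‖ ^ 2 + ‖v‖ ^ 2
  have hS0 : 0 ≤ S := by positivity
  have huv : RCLike.re (inner ℂ u v) ≤ η * ‖ξ‖ ^ 2 := by
    have : inner ℂ u v = inner ℂ ξ ((star p * r) ξ) :=
      (ContinuousLinearMap.adjoint_inner_right p ξ (r ξ)).symm
    rw [this]
    refine (re_inner_le_norm (𝕜 := ℂ) _ _).trans ?_
    have := ((star p * r).le_opNorm ξ).trans (mul_le_mul_of_nonneg_right h1 (norm_nonneg _))
    nlinarith [norm_nonneg ξ]
  have hT : ‖(star p) u + (star r) v‖ ^ 2 ≤ (M ^ 2 + η) * S := by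
    rw [norm_add_sq (𝕜 := ℂ)]
    have a1 : ‖(star p) u‖ ≤ M * ‖u‖ := ((star p).le_opNorm u).trans
      (mul_le_mul_of_nonneg_right (by rwa [norm_star]) (norm_nonneg _))
    have a2 : ‖(star r) v‖ ≤ M * ‖v‖ := ((star r).le_opNorm v).trans
      (mul_le_mul_of_nonneg_right (by rwa [norm_star]) (norm_nonneg _))
    have a3 : RCLike.re (inner ℂ ((star p) u) ((star r) v)) ≤ η * (‖u‖ * ‖v‖) := by
      have : inner ℂ ((star p) u) ((star r) v) = inner ℂ ((r * star p) u) v :=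
        ContinuousLinearMap.adjoint_inner_right r _ _
      rw [this]
      refine (re_inner_le_norm (𝕜 := ℂ) _ _).trans ?_
      rw [← mul_assoc]
      exact mul_le_mul_of_nonneg_right (((r * star p).le_opNorm u).trans
        (mul_le_mul_of_nonneg_right h2 (norm_nonneg _))) (norm_nonneg _)
    have a4 := pow_le_pow_left₀ (norm_nonneg _) a1 2
    have a5 := pow_le_pow_left₀ (norm_nonneg _) a2 2
    have a6 : η * (2 * (‖u‖ * ‖v‖)) ≤ η * S :=
      mul_le_mul_of_nonneg_left (by have := two_mul_le_add_sq ‖u‖ ‖v‖; simp only [S]; linarith) hη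
    simp only [S] at *
    nlinarith
  have hS : S ≤ (M ^ 2 + η) * ‖ξ‖ ^ 2 := by
    have b1 : S ≤ ‖ξ‖ * ‖(star p) u + (star r) v‖ := by
      have e1 : inner ℂ ξ ((star p) u) = inner ℂ u u :=
        ContinuousLinearMap.adjoint_inner_right p ξ u
      have e2 : inner ℂ ξ ((star r) v) = inner ℂ v v :=
        ContinuousLinearMap.adjoint_inner_right r ξ v
      have e3 : S = RCLike.re (inner ℂ ξ ((star p) u + (star r) v)) := by
        rw [inner_add_right, map_add, e1, e2, inner_self_eq_norm_sq (𝕜 := ℂ),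
          inner_self_eq_norm_sq (𝕜 := ℂ)]
      rw [e3]
      exact re_inner_le_norm (𝕜 := ℂ) _ _
    have b2 := pow_le_pow_left₀ hS0 b1 2
    rw [mul_pow] at b2
    have b3 := mul_le_mul_of_nonneg_left hT (sq_nonneg ‖ξ‖)
    rcases hS0.eq_or_lt with h | h
    · rw [← h]; positivity
    · refine le_of_mul_le_mul_right ?_ h
      nlinarith
  rw [norm_add_sq (𝕜 := ℂ)]
  nlinarith

/-- Expanding `(∑ u k)* (∑ u j)`, only the `N` diagonal terms are large. The sum thus grows like
`√N`, and its average tends to 0 if `θ` does. -/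
theorem norm_sum_sq_le_of_almost_orthogonal {u : ℕ → H →L[ℂ] H} {M θ : ℝ} (hM : ∀ k, ‖u k‖ ≤ M)
    (hθ : 0 ≤ θ) (h : ∀ k j, k < j → ‖star (u k) * u j‖ ≤ θ) (N : ℕ) :
    ‖∑ k ∈ Finset.range N, u k‖ ^ 2 ≤ N * M ^ 2 + N ^ 2 * θ := by
  have hM0 : 0 ≤ M := (norm_nonneg _).trans (hM 0)
  have key : ∀ k j, ‖star (u k) * u j‖ ≤ (if k = j then M ^ 2 else 0) + θ := fun k j => by
    rcases lt_trichotomy k j with hkj | rfl | hkj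
    · simpa [hkj.ne] using h k j hkj
    · rw [if_pos rfl, CStarRing.norm_star_mul_self, ← sq]
      exact (pow_le_pow_left₀ (norm_nonneg _) (hM k) 2).trans (le_add_of_nonneg_right hθ)
    · rw [if_neg hkj.ne', zero_add, ← norm_star, star_mul, star_star]
      exact h j k hkj
  rw [sq, ← CStarRing.norm_star_mul_self, star_sum, Finset.sum_mul_sum]
  refine (norm_sum_le_of_le _ fun k hk => norm_sum_le_of_le _ fun j _ => key k j).trans ?_
  simp only [Finset.sum_add_distrib, Finset.sum_ite_eq, Finset.sum_const, Finset.card_range,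
    nsmul_eq_mul]
  rw [Finset.sum_congr rfl fun k hk => if_pos hk, Finset.sum_const, Finset.card_range, nsmul_eq_mul]
  exact le_of_eq (by ring)

/-- `e` and its adjoint are units for `s`, up to `η`. -/
structure IsNearUnit (η : ℝ) (e s : H →L[ℂ] H) : Prop where
  mul_left : ‖e * s - s‖ ≤ η
  mul_right : ‖s * e - s‖ ≤ η
  star_mul_left : ‖star e * s - s‖ ≤ η
  star_mul_right : ‖s * star e - s‖ ≤ η

theorem eventually_isNearUnit {l : Filter (H →L[ℂ] H)} (hl : ∀ᶠ e in l, ‖e‖ ≤ 1) {s : H →L[ℂ] H}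
    (h1 : Tendsto (fun e => e * s) l (𝓝 s)) (h2 : Tendsto (fun e => s * e) l (𝓝 s)) {η : ℝ}
    (hη : 0 < η) : ∀ᶠ e in l, IsNearUnit η e s := by
  have h1' := tendsto_iff_norm_sub_tendsto_zero.1 h1
  have h2' := tendsto_iff_norm_sub_tendsto_zero.1 h2
  have h3 := h1'.const_mul (2 * ‖s‖)
  have h4 := h2'.const_mul (2 * ‖s‖)
  rw [mul_zero] at h3 h4
  have hη2 : 0 < η ^ 2 := by positivity
  filter_upwards [hl, h1'.eventually_le_const hη, h2'.eventually_le_const hη,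
    h3.eventually_le_const hη2, h4.eventually_le_const hη2] with e he a1 a2 a3 a4
  refine ⟨a1, a2, le_of_sq_le_sq ((norm_star_mul_sub_sq_le he s).trans a3) hη.le, ?_⟩
  have := norm_star_mul_sub_sq_le (e := star e) (by rwa [norm_star]) (star s)
  rw [norm_star s, ← star_mul, ← star_mul, ← star_sub, ← star_sub, norm_star, norm_star] at this
  exact le_of_sq_le_sq (this.trans a4) hη.le

end NearUnit

/-! ### Gluing approximate units of an ideal and a quotient -/

section ExtensionUnit

variable {H : Type*} [NormedAddCommGroup H] [InnerProductSpace ℂ H] [CompleteSpace H]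

/-- A sequence in `I` each of whose terms is almost a unit for the products of the earlier ones
with the elements of `S`. -/
theorem exists_nearUnit_seq {I : Set (H →L[ℂ] H)} {l : Filter (H →L[ℂ] H)} [l.NeBot] {δ η : ℝ}
    (hη : 0 < η) (hl : ∀ᶠ e in l, e ∈ I ∧ ‖e‖ ≤ 1 ∧ ‖1 - e‖ ≤ 1 + δ)
    (hleft : ∀ a ∈ I, Tendsto (fun e => e * a) l (𝓝 a))
    (hright : ∀ a ∈ I, Tendsto (fun e => a * e) l (𝓝 a))
    {S T : Finset (H →L[ℂ] H)} (hT : ∀ a ∈ T, a ∈ I)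
    (hSI : ∀ b ∈ S, ∀ a ∈ I, b * a ∈ I ∧ a * b ∈ I) :
    ∃ e : ℕ → H →L[ℂ] H,
      (∀ n, (e n ∈ I ∧ ‖e n‖ ≤ 1 ∧ ‖1 - e n‖ ≤ 1 + δ) ∧ ∀ a ∈ T, IsNearUnit η (e n) a) ∧
      ∀ m n, m < n → IsNearUnit η (e n) (e m) ∧
        ∀ b ∈ S, IsNearUnit η (e n) (b * e m) ∧ IsNearUnit η (e n) (e m * b) := by
  have hnear : ∀ s ∈ I, ∀ᶠ e in l, IsNearUnit η e s := fun s hs =>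
    eventually_isNearUnit (hl.mono fun e he => he.2.1) (hleft s hs) (hright s hs) hη
  refine exists_seq_of_forall_finset_exists
    (fun e => (e ∈ I ∧ ‖e‖ ≤ 1 ∧ ‖1 - e‖ ≤ 1 + δ) ∧ ∀ a ∈ T, IsNearUnit η e a)
    (fun e e' => IsNearUnit η e' e ∧
      ∀ b ∈ S, IsNearUnit η e' (b * e) ∧ IsNearUnit η e' (e * b)) fun s hs => ?_
  -- Each new term meets finitely many conditions, and each of them holds eventually along `l`.
  refine Eventually.exists (f := l) ((hl.and ((eventually_all_finset T).2 fun a ha =>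
    hnear a (hT a ha))).and ((eventually_all_finset s).2 fun a ha => ?_))
  have haI := (hs a ha).1.1
  refine (hnear a haI).and ((eventually_all_finset S).2 fun b hb => ?_)
  exact (hnear _ (hSI b hb a haI).1).and (hnear _ (hSI b hb a haI).2)

/-- Almost a unit for the finite subset `S` of an algebra `B` with an ideal `I`, obtained from an
approximate unit of `I` and an element `x` of `B` which is almost a unit for `S` modulo `I`. -/
theorem exists_nearUnit_of_ideal {B : NonUnitalSubalgebra ℂ (H →L[ℂ] H)} {I : Set (H →L[ℂ] H)}
    (hIB : I ⊆ B) (hBI : ∀ b ∈ B, ∀ a ∈ I, b * a ∈ I ∧ a * b ∈ I)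
    {l : Filter (H →L[ℂ] H)} [l.NeBot] {δ η K : ℝ} (hδ : 0 < δ) (hδ1 : δ ≤ 1) (hη : 0 < η)
    (hl : ∀ᶠ e in l, e ∈ I ∧ ‖e‖ ≤ 1 ∧ ‖1 - e‖ ≤ 1 + δ)
    (hleft : ∀ a ∈ I, Tendsto (fun e => e * a) l (𝓝 a))
    (hright : ∀ a ∈ I, Tendsto (fun e => a * e) l (𝓝 a))
    {S : Finset (H →L[ℂ] H)} (hS : ∀ b ∈ S, b ∈ B) (hK : ∀ b ∈ S, ‖b‖ ≤ K)
    {x : H →L[ℂ] H} (hxB : x ∈ B) (hx1 : ‖x‖ ≤ 1)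
    (hx : ∀ b ∈ S, (∃ a ∈ I, ‖x * b - b - a‖ ≤ η) ∧ ∃ a ∈ I, ‖b * x - b - a‖ ≤ η)
    {N : ℕ} (hN : 0 < N) :
    ∃ y ∈ B, ‖y‖ ≤ √((1 + δ) ^ 2 + 9 * η) ∧ ∀ b ∈ S,
      ‖y * b - b‖ ≤ (N : ℝ)⁻¹ * (4 * K + N * (3 * η)) ∧
      ‖b * y - b‖ ≤ (N : ℝ)⁻¹ * (4 * K + N * (3 * η) +
        2 * √(N * (2 * K) ^ 2 + N ^ 2 * (2 * K * η * (K + 3)))) := by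
  classical
  have hN0 : (0 : ℝ) < N := by exact_mod_cast hN
  have hNc : (N : ℂ) ≠ 0 := by exact_mod_cast hN.ne'
  have hNn : ‖(N : ℂ)⁻¹‖ = (N : ℝ)⁻¹ := by simp
  choose! a haI ha using fun b hb => (hx b hb).1
  choose! a' haI' ha' using fun b hb => (hx b hb).2
  obtain ⟨e, he, hr⟩ := exists_nearUnit_seq hη hl hleft hright (S := insert x S)
    (T := S.image a ∪ S.image a')
    (by
      intro c hc
      rcases Finset.mem_union.1 hc with h | h
      · obtain ⟨b, hb, rfl⟩ := Finset.mem_image.1 h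
        exact haI b hb
      · obtain ⟨b, hb, rfl⟩ := Finset.mem_image.1 h
        exact haI' b hb)
    (by
      intro b hb
      rcases Finset.mem_insert.1 hb with rfl | hb
      · exact hBI _ hxB
      · exact hBI b (hS b hb))
  have hx1' : ‖x - 1‖ ≤ 2 := by
    refine (norm_sub_le _ _).trans ?_
    have : ‖(1 : H →L[ℂ] H)‖ ≤ 1 := ContinuousLinearMap.norm_id_le
    linarith
  let g : ℕ → H →L[ℂ] H := fun k => 1 - e (2 * k)
  have hg : ∀ k, ‖g k‖ ≤ 1 + δ := fun k => (he _).1.2.2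
  have hg2 : ∀ k, ‖g k‖ ≤ 2 := fun k => (hg k).trans (by linarith)
  -- Using the later unit in `g (k + 1) = 1 - e (2k + 2)` makes the two summands almost orthogonal,
  -- so the norm stays near `1 + δ` instead of adding up. The odd terms of `e` are buffers.
  let w : ℕ → H →L[ℂ] H := fun k => e (2 * k) + g (k + 1) * x
  have hwB : ∀ k, w k ∈ B := fun k => by
    have : w k = e (2 * k) + (x - e (2 * (k + 1)) * x) := by
      simp only [w, g, sub_mul, one_mul]
    rw [this]
    exact add_mem (hIB (he _).1.1) (sub_mem hxB (mul_mem (hIB (he _).1.1) hxB))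
  have hw : ∀ k, ‖w k‖ ≤ √((1 + δ) ^ 2 + 9 * η) := fun k => by
    refine Real.le_sqrt_of_sq_le ?_
    have h1 := hr (2 * k) (2 * k + 1) (by lia)
    have h2 := hr (2 * k) (2 * (k + 1)) (by lia)
    have h3 := hr (2 * k + 1) (2 * (k + 1)) (by lia)
    have b1 : ‖star (e (2 * k)) * (g (k + 1) * x)‖ ≤ 3 * η := by
      rw [← mul_assoc]
      refine (norm_mul_le _ _).trans ((mul_le_of_le_one_right (norm_nonneg _) hx1).trans ?_)
      have e1 : star (e (2 * k)) * g (k + 1) =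
          -star (star (e (2 * (k + 1))) * e (2 * k) - e (2 * k)) := by
        simp only [g, mul_sub, mul_one, star_sub, star_mul, star_star, neg_sub]
      rw [e1, norm_neg, norm_star]
      exact h2.1.star_mul_left.trans (by linarith)
    -- The adjoint of `e (2k)` need not lie in `I`, so `e (2k + 1)` is inserted before it at small
    -- cost; then `x * e (2k + 1)` is in `I` and `g (k + 1)` almost kills it.
    have b2 : ‖g (k + 1) * x * star (e (2 * k))‖ ≤ 3 * η := by
      have e1 : g (k + 1) * x * star (e (2 * k)) =
          -(g (k + 1) * x * star (e (2 * k) * star (e (2 * k + 1)) - e (2 * k))) -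
          (e (2 * (k + 1)) * (x * e (2 * k + 1)) - x * e (2 * k + 1)) * star (e (2 * k)) := by
        simp only [g, star_sub, star_mul, star_star, sub_mul, one_mul, mul_sub, mul_assoc]
        abel
      rw [e1]
      refine (norm_sub_le _ _).trans ?_
      rw [norm_neg]
      have c1 : ‖g (k + 1) * x * star (e (2 * k) * star (e (2 * k + 1)) - e (2 * k))‖ ≤ 2 * η := by
        refine (norm_mul_le _ _).trans (mul_le_mul ?_ ?_ (norm_nonneg _) zero_le_two)
        · exact (norm_mul_le _ _).trans
            ((mul_le_of_le_one_right (norm_nonneg _) hx1).trans (hg2 _))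
        · rw [norm_star]
          exact h1.1.star_mul_right
      have c2 : ‖(e (2 * (k + 1)) * (x * e (2 * k + 1)) - x * e (2 * k + 1)) *
          star (e (2 * k))‖ ≤ η := by
        refine (norm_mul_le _ _).trans ((mul_le_of_le_one_right (norm_nonneg _) ?_).trans
          (h3.2 x (Finset.mem_insert_self _ _)).1.mul_left)
        rw [norm_star]
        exact (he _).1.2.1
      linarith
    have := norm_add_sq_le_of_almost_orthogonal (M := 1 + δ) (η := 3 * η)
      ((he (2 * k)).1.2.1.trans (by linarith))
      ((norm_mul_le _ _).trans ((mul_le_of_le_one_right (norm_nonneg _) hx1).trans (hg (k + 1))))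
      b1 b2
    exact this.trans (by linarith)
  have hga : ∀ k, ∀ b ∈ S, ‖g k * (x * b - b)‖ ≤ 3 * η := fun k b hb => by
    have e1 : g k * (x * b - b) = g k * (x * b - b - a b) - (e (2 * k) * a b - a b) := by
      simp only [g, sub_mul, mul_sub, one_mul]
      abel
    rw [e1]
    refine (norm_sub_le _ _).trans ?_
    have c1 : ‖g k * (x * b - b - a b)‖ ≤ 2 * η :=
      (norm_mul_le _ _).trans (mul_le_mul (hg2 k) (ha b hb) (norm_nonneg _) zero_le_two)
    have c2 := ((he (2 * k)).2 (a b)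
      (Finset.mem_union_left _ (Finset.mem_image_of_mem _ hb))).mul_left
    linarith
  have hga' : ∀ k, ∀ b ∈ S, ‖g k * (b * x - b)‖ ≤ 3 * η := fun k b hb => by
    have e1 : g k * (b * x - b) = g k * (b * x - b - a' b) - (e (2 * k) * a' b - a' b) := by
      simp only [g, sub_mul, mul_sub, one_mul]
      abel
    rw [e1]
    refine (norm_sub_le _ _).trans ?_
    have c1 : ‖g k * (b * x - b - a' b)‖ ≤ 2 * η :=
      (norm_mul_le _ _).trans (mul_le_mul (hg2 k) (ha' b hb) (norm_nonneg _) zero_le_two)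
    have c2 := ((he (2 * k)).2 (a' b)
      (Finset.mem_union_right _ (Finset.mem_image_of_mem _ hb))).mul_left
    linarith
  -- The mismatch between `e (2k)` and `e (2k + 2)` telescopes to `g N - g 0`, of norm at most 4
  -- whatever `N` is.
  have hsum : ∑ k ∈ Finset.range N, w k = (N : ℂ) • (1 : H →L[ℂ] H) + (g N - g 0) +
      ∑ k ∈ Finset.range N, g (k + 1) * (x - 1) := by
    have : ∀ k, w k = 1 + (g (k + 1) - g k) + g (k + 1) * (x - 1) := fun k => by
      simp only [w, g, mul_sub, mul_one]
      abel
    rw [Finset.sum_congr rfl fun k _ => this k, Finset.sum_add_distrib, Finset.sum_add_distrib,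
      Finset.sum_range_sub, Finset.sum_const, Finset.card_range, Nat.cast_smul_eq_nsmul]
  have hy : (N : ℂ)⁻¹ • ∑ k ∈ Finset.range N, w k = 1 + (N : ℂ)⁻¹ • ((g N - g 0) +
      ∑ k ∈ Finset.range N, g (k + 1) * (x - 1)) := by
    rw [hsum, add_assoc, smul_add, smul_smul, inv_mul_cancel₀ hNc, one_smul]
  have hgg : ‖g N - g 0‖ ≤ 4 := (norm_sub_le _ _).trans (by linarith [hg2 N, hg2 0])
  refine ⟨(N : ℂ)⁻¹ • ∑ k ∈ Finset.range N, w k, SMulMemClass.smul_mem _ (sum_mem fun k _ => hwB k), ?_,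
    fun b hb => ⟨?_, ?_⟩⟩
  · rw [norm_smul, hNn, inv_mul_le_iff₀ hN0]
    refine (norm_sum_le_of_le _ fun k _ => hw k).trans ?_
    simp
  · have e1 : ((N : ℂ)⁻¹ • ∑ k ∈ Finset.range N, w k) * b - b = (N : ℂ)⁻¹ •
        ((g N - g 0) * b + ∑ k ∈ Finset.range N, g (k + 1) * (x * b - b)) := by
      rw [hy, add_mul, one_mul, add_sub_cancel_left, smul_mul_assoc, add_mul, Finset.sum_mul]
      simp only [mul_assoc, sub_mul x, one_mul]
    rw [e1, norm_smul, hNn]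
    refine mul_le_mul_of_nonneg_left ((norm_add_le _ _).trans (add_le_add ?_ ?_)) (by positivity)
    · exact (norm_mul_le _ _).trans (mul_le_mul hgg (hK b hb) (norm_nonneg _) (by norm_num))
    · refine (norm_sum_le_of_le _ fun k _ => hga (k + 1) b hb).trans ?_
      simp
  -- From the right, `b` has to be moved past `g (k + 1)`, which leaves the commutator `u k`. Its
  -- norm need not be small, as the approximate unit is not assumed quasicentral; it is the average
  -- of the `u k` that is small.
  · let u : ℕ → H →L[ℂ] H := fun k => e (2 * (k + 1)) * b - b * e (2 * (k + 1))
    have hbK := hK b hb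
    have hK0 : 0 ≤ K := (norm_nonneg b).trans hbK
    have hbS : b ∈ insert x S := Finset.mem_insert_of_mem hb
    have hu : ∀ k, ‖u k‖ ≤ 2 * K := fun k => by
      have h1 := (norm_mul_le (e (2 * (k + 1))) b).trans
        (mul_le_of_le_one_left (norm_nonneg _) (he _).1.2.1)
      have h2 := (norm_mul_le b (e (2 * (k + 1)))).trans
        (mul_le_of_le_one_right (norm_nonneg _) (he _).1.2.1)
      exact (norm_sub_le _ _).trans (by linarith)
    -- The buffer `m` lies between the two indices: `m*` almost fixes `u k`, while `m u j ≈ mb - mb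
    -- = 0`, because `e (2j + 2)` is almost a right unit for both `m` and `m b`.
    have horth : ∀ k j, k < j → ‖star (u k) * u j‖ ≤ 2 * K * η * (K + 3) := fun k j hkj => by
      set m := e (2 * k + 3)
      have h1 := (hr (2 * (k + 1)) (2 * k + 3) (by lia)).2 b hbS
      have h2 := hr (2 * k + 3) (2 * (j + 1)) (by lia)
      have c1 : ‖star m * u k - u k‖ ≤ 2 * η := by
        have : star m * u k - u k = (star m * (e (2 * (k + 1)) * b) - e (2 * (k + 1)) * b) -
            (star m * (b * e (2 * (k + 1))) - b * e (2 * (k + 1))) := by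
          simp only [u, mul_sub]
          abel
        rw [this]
        exact (norm_sub_le _ _).trans (by linarith [h1.1.star_mul_left, h1.2.star_mul_left])
      have c2 : ‖m * u j‖ ≤ η * K + η := by
        have : m * u j = (m * e (2 * (j + 1)) - m) * b -
            (m * b * e (2 * (j + 1)) - m * b) := by
          simp only [u, mul_sub, sub_mul, mul_assoc]
          abel
        rw [this]
        refine (norm_sub_le _ _).trans (add_le_add ?_ (h2.2 b hbS).2.mul_right)
        exact (norm_mul_le _ _).trans (mul_le_mul h2.1.mul_right hbK (norm_nonneg _) hη.le)
      have : star (u k) * u j = star (u k) * (m * u j) - star (star m * u k - u k) * u j := by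
        simp only [star_sub, star_mul, star_star, sub_mul, mul_assoc]
        abel
      rw [this]
      have d1 : ‖star (u k) * (m * u j)‖ ≤ 2 * K * (η * K + η) := by
        refine (norm_mul_le _ _).trans (mul_le_mul ?_ c2 (norm_nonneg _) (by positivity))
        rw [norm_star]
        exact hu k
      have d2 : ‖star (star m * u k - u k) * u j‖ ≤ 2 * η * (2 * K) := by
        refine (norm_mul_le _ _).trans (mul_le_mul ?_ (hu j) (norm_nonneg _) (by positivity))
        rw [norm_star]
        exact c1
      exact (norm_sub_le _ _).trans (by linarith)
    have hus := Real.le_sqrt_of_sq_le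
      (norm_sum_sq_le_of_almost_orthogonal hu (by positivity) horth N)
    have e1 : b * ((N : ℂ)⁻¹ • ∑ k ∈ Finset.range N, w k) - b = (N : ℂ)⁻¹ •
        (b * (g N - g 0) + ∑ k ∈ Finset.range N, g (k + 1) * (b * x - b) +
          (∑ k ∈ Finset.range N, u k) * (x - 1)) := by
      have h1 : ∀ k, g (k + 1) * (b * x - b) = b * (g (k + 1) * (x - 1)) - u k * (x - 1) :=
        fun k => by
          simp only [g, u, mul_sub, sub_mul, mul_one, one_mul, mul_assoc]
          abel
      rw [hy, mul_add, mul_one, add_sub_cancel_left, mul_smul_comm, mul_add, Finset.mul_sum,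
        Finset.sum_congr rfl fun k _ => h1 k, Finset.sum_sub_distrib, Finset.sum_mul, add_assoc,
        sub_add_cancel]
    rw [e1, norm_smul, hNn]
    refine mul_le_mul_of_nonneg_left ((norm_add_le _ _).trans (add_le_add
      ((norm_add_le _ _).trans (add_le_add ?_ ?_)) ?_)) (by positivity)
    · rw [mul_comm 4 K]
      exact (norm_mul_le _ _).trans (mul_le_mul hbK hgg (norm_nonneg _) hK0)
    · refine (norm_sum_le_of_le _ fun k _ => hga' (k + 1) b hb).trans ?_
      simp
    · rw [mul_comm 2]
      exact (norm_mul_le _ _).trans (mul_le_mul hus hx1' (norm_nonneg _) (Real.sqrt_nonneg _))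

/-- An algebra `B` has almost units for finite sets if an ideal `I` has a regular approximate unit
and there are almost units modulo `I`. -/
theorem exists_nearUnit_of_forall_exists_mod {B : NonUnitalSubalgebra ℂ (H →L[ℂ] H)}
    {I : Set (H →L[ℂ] H)} (hIB : I ⊆ B) (hBI : ∀ b ∈ B, ∀ a ∈ I, b * a ∈ I ∧ a * b ∈ I)
    (hl : ∀ δ > 0, ∃ l : Filter (H →L[ℂ] H), l.NeBot ∧
      (∀ᶠ e in l, e ∈ I ∧ ‖e‖ ≤ 1 ∧ ‖1 - e‖ ≤ 1 + δ) ∧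
      (∀ a ∈ I, Tendsto (fun e => e * a) l (𝓝 a)) ∧ ∀ a ∈ I, Tendsto (fun e => a * e) l (𝓝 a))
    {S : Finset (H →L[ℂ] H)} (hS : ∀ b ∈ S, b ∈ B)
    (hx : ∀ η > 0, ∃ x ∈ B, ‖x‖ ≤ 1 ∧
      ∀ b ∈ S, (∃ a ∈ I, ‖x * b - b - a‖ ≤ η) ∧ ∃ a ∈ I, ‖b * x - b - a‖ ≤ η)
    {ε : ℝ} (hε : 0 < ε) :
    ∃ y ∈ B, ‖y‖ ≤ 1 + ε ∧ ∀ b ∈ S, ‖y * b - b‖ ≤ ε ∧ ‖b * y - b‖ ≤ ε := by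
  have hK : ∀ b ∈ S, ‖b‖ ≤ ∑ b ∈ S, ‖b‖ := fun b hb =>
    Finset.single_le_sum (f := fun b => ‖b‖) (fun _ _ => norm_nonneg _) hb
  set K := ∑ b ∈ S, ‖b‖
  -- The cap 1 yields `‖1 - e‖ ≤ 2`; `ε / 2` leaves room below `1 + ε` for the error under the
  -- square root.
  have hδ : 0 < min (ε / 2) 1 := by positivity
  obtain ⟨l, hlne, hl1, hl2, hl3⟩ := hl _ hδ
  set δ := min (ε / 2) 1
  have hδε : δ < ε := (min_le_left _ _).trans_lt (half_lt_self hε)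
  have hinv : Tendsto (fun N : ℕ => (N : ℝ)⁻¹) atTop (𝓝 0) := tendsto_inv_atTop_nhds_zero_nat
  have t1 : Tendsto (fun N : ℕ => √((1 + δ) ^ 2 + 9 * (N : ℝ)⁻¹)) atTop (𝓝 (1 + δ)) := by
    have := ((hinv.const_mul 9).const_add ((1 + δ) ^ 2)).sqrt
    rwa [mul_zero, add_zero, Real.sqrt_sq (by positivity)] at this
  have t2 : Tendsto (fun N : ℕ => 4 * K * (N : ℝ)⁻¹ + 3 * (N : ℝ)⁻¹) atTop (𝓝 0) := by
    simpa using (hinv.const_mul (4 * K)).add (hinv.const_mul 3)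
  have t3 : Tendsto (fun N : ℕ => 4 * K * (N : ℝ)⁻¹ + 3 * (N : ℝ)⁻¹ +
      2 * √(((2 * K) ^ 2 + 2 * K * (K + 3)) * (N : ℝ)⁻¹)) atTop (𝓝 0) := by
    simpa using t2.add ((hinv.const_mul ((2 * K) ^ 2 + 2 * K * (K + 3))).sqrt.const_mul 2)
  -- The choice `η = 1/N` makes `N²η` of order `N`, so the averaged commutator term is of order
  -- `N^(-1/2)`.
  obtain ⟨N, ⟨⟨hN1, hN2⟩, hN3⟩, hN0⟩ := (((t1.eventually_le_const (add_lt_add_right hδε 1)).and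
    (t2.eventually_le_const hε)).and (t3.eventually_le_const hε)).and
    (eventually_gt_atTop 0) |>.exists
  have hNr : (0 : ℝ) < N := by exact_mod_cast hN0
  have hη : 0 < (N : ℝ)⁻¹ := by positivity
  obtain ⟨x, hxB, hx1, hx2⟩ := hx _ hη
  obtain ⟨y, hy, hy1, hy2⟩ := exists_nearUnit_of_ideal hIB hBI hδ (min_le_right _ _) hη hl1 hl2 hl3
    hS hK hxB hx1 hx2 hN0
  have q1 : (N : ℝ)⁻¹ * (4 * K + N * (3 * (N : ℝ)⁻¹)) = 4 * K * (N : ℝ)⁻¹ + 3 * (N : ℝ)⁻¹ := by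
    field_simp
  have q2 : (N : ℝ)⁻¹ * (2 * √(N * (2 * K) ^ 2 + N ^ 2 * (2 * K * (N : ℝ)⁻¹ * (K + 3)))) =
      2 * √(((2 * K) ^ 2 + 2 * K * (K + 3)) * (N : ℝ)⁻¹) := by
    have : N * (2 * K) ^ 2 + N ^ 2 * (2 * K * (N : ℝ)⁻¹ * (K + 3)) =
        (N : ℝ) ^ 2 * (((2 * K) ^ 2 + 2 * K * (K + 3)) * (N : ℝ)⁻¹) := by
      field_simp
    rw [this, Real.sqrt_mul (by positivity), Real.sqrt_sq hNr.le]
    field_simp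
  refine ⟨y, hy, hy1.trans hN1, fun b hb => ⟨?_, ?_⟩⟩
  · exact ((hy2 b hb).1.trans_eq q1).trans hN2
  · refine (hy2 b hb).2.trans ?_
    rw [mul_add, q1, q2]
    exact hN3

end ExtensionUnit

/-- A finite-set criterion for a contractive approximate identity. -/
theorem approxUnital_of_forall_finset {V : Type*} [NonUnitalNormedRing V] [NormedSpace ℂ V]
    [IsScalarTower ℂ V V] [SMulCommClass ℂ V V]
    (h : ∀ (S : Finset V) (ε : ℝ), 0 < ε →
      ∃ y : V, ‖y‖ ≤ 1 + ε ∧ ∀ b ∈ S, ‖y * b - b‖ ≤ ε ∧ ‖b * y - b‖ ≤ ε) : ApproxUnital V := by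
  classical
  have h' : ∀ i : Finset V × ℕ, ∃ y : V, ‖y‖ ≤ 1 + ((i.2 : ℝ) + 1)⁻¹ ∧
      ∀ b ∈ i.1, ‖y * b - b‖ ≤ ((i.2 : ℝ) + 1)⁻¹ ∧ ‖b * y - b‖ ≤ ((i.2 : ℝ) + 1)⁻¹ := fun i =>
    h i.1 _ (by positivity)
  choose y hy hyb using h'
  -- Rescaling by `t i → 1` turns norms at most `1 + 1/(n + 1)` into contractions without changing
  -- limits.
  let t : Finset V × ℕ → ℝ := fun i => (1 + ((i.2 : ℝ) + 1)⁻¹)⁻¹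
  have hsnd : Tendsto (fun i : Finset V × ℕ => ((i.2 : ℝ) + 1)⁻¹) atTop (𝓝 0) := by
    have : Tendsto (fun n : ℕ => ((n : ℝ) + 1)⁻¹) atTop (𝓝 0) := by
      simpa [one_div] using tendsto_one_div_add_atTop_nhds_zero_nat (𝕜 := ℝ)
    rw [← prod_atTop_atTop_eq]
    exact this.comp tendsto_snd
  have ht : Tendsto (fun i => ((t i : ℝ) : ℂ)) atTop (𝓝 1) := by
    have h1 : Tendsto t atTop (𝓝 1) := by
      simpa [t] using (hsnd.const_add 1).inv₀ (by norm_num)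
    exact_mod_cast (Complex.continuous_ofReal.tendsto 1).comp h1
  have hmem : ∀ b : V, ∀ᶠ i : Finset V × ℕ in atTop, b ∈ i.1 := fun b => by
    filter_upwards [eventually_ge_atTop (({b} : Finset V), 0)] with i hi
    exact hi.1 (Finset.mem_singleton_self b)
  have hL : ∀ b : V, Tendsto (fun i => y i * b) atTop (𝓝 b) := fun b =>
    tendsto_iff_norm_sub_tendsto_zero.2 <| squeeze_zero' (Eventually.of_forall fun _ => norm_nonneg _)
      ((hmem b).mono fun i hi => (hyb i b hi).1) hsnd
  have hR : ∀ b : V, Tendsto (fun i => b * y i) atTop (𝓝 b) := fun b =>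
    tendsto_iff_norm_sub_tendsto_zero.2 <| squeeze_zero' (Eventually.of_forall fun _ => norm_nonneg _)
      ((hmem b).mono fun i hi => (hyb i b hi).2) hsnd
  refine ⟨atTop.map fun i => ((t i : ℝ) : ℂ) • y i,
    { tendsto_mul_left := fun b => ?_, tendsto_mul_right := fun b => ?_, neBot := inferInstance },
    eventually_map.2 (Eventually.of_forall fun i => ?_)⟩
  · rw [tendsto_map'_iff]
    simpa [Function.comp_def, mul_smul_comm] using ht.smul (hR b)
  · rw [tendsto_map'_iff]
    simpa [Function.comp_def, smul_mul_assoc] using ht.smul (hL b)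
  · have hp : 0 < 1 + ((i.2 : ℝ) + 1)⁻¹ := by positivity
    rw [norm_smul, Complex.norm_of_nonneg (inv_nonneg.2 hp.le), inv_mul_le_iff₀ hp, mul_one]
    exact hy i

/-! ### Approximate units in extensions -/

section ExtensionApproxUnital

theorem exists_lift_lt {B C : Type*} [NonUnitalNormedRing B] [NormedSpace ℂ B]
    [NonUnitalNormedRing C] [NormedSpace ℂ C] {q : B →ₙₐ[ℂ] C}
    (hq : ∀ c : C, ‖c‖ < 1 → ∃ b, ‖b‖ < 1 ∧ q b = c) {c : C} {r : ℝ} (hc : ‖c‖ < r) :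
    ∃ b, ‖b‖ < r ∧ q b = c := by
  have hr : 0 < r := (norm_nonneg _).trans_lt hc
  have hrc : (r : ℂ) ≠ 0 := by exact_mod_cast hr.ne'
  have hrn : ‖(r : ℂ)‖ = r := Complex.norm_of_nonneg hr.le
  obtain ⟨b, hb, hbc⟩ := hq ((r : ℂ)⁻¹ • c) (by
    rwa [norm_smul, norm_inv, hrn, inv_mul_lt_iff₀ hr, mul_one])
  refine ⟨(r : ℂ) • b, ?_, by rw [map_smul, hbc, smul_smul, mul_inv_cancel₀ hrc, one_smul]⟩
  rw [norm_smul, hrn]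
  exact mul_lt_of_lt_one_right hr hb

/-- An extension of an approximately unital operator algebra by an approximately unital operator
algebra is approximately unital. -/
theorem approxUnital_of_exact {H : Type*} [NormedAddCommGroup H] [InnerProductSpace ℂ H]
    [CompleteSpace H] {A B C : Type*} [NonUnitalNormedRing A] [NormedSpace ℂ A]
    [NonUnitalNormedRing B] [NormedSpace ℂ B] [IsScalarTower ℂ B B] [SMulCommClass ℂ B B]
    [NonUnitalNormedRing C] [NormedSpace ℂ C] [IsScalarTower ℂ C C] [SMulCommClass ℂ C C]
    {φ : A →ₙₐ[ℂ] B} {q : B →ₙₐ[ℂ] C} {κ : B →ₙₐ[ℂ] (H →L[ℂ] H)}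
    (hφ : ∀ a, ‖φ a‖ = ‖a‖) (hκ : ∀ b, ‖κ b‖ = ‖b‖) (hex : Function.Exact φ q)
    (hq : ∀ c : C, ‖c‖ < 1 → ∃ b, ‖b‖ < 1 ∧ q b = c) (hC : ApproxUnital C)
    (hA : ∀ δ > 0, ∃ l : Filter A, l.IsApproximateUnit ∧
      ∀ᶠ e in l, ‖e‖ ≤ 1 ∧ IsRegularized δ e) : ApproxUnital B := by
  classical
  let ψ : A →ₙₐ[ℂ] (H →L[ℂ] H) := κ.comp φ
  have hψ : ∀ a, ‖ψ a‖ = ‖a‖ := fun a => (hκ _).trans (hφ a)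
  have hψc : Continuous ψ := (AddMonoidHomClass.isometry_of_norm ψ hψ).continuous
  have hk : ∀ a, q (φ a) = 0 := fun a => (hex _).2 ⟨a, rfl⟩
  refine approxUnital_of_forall_finset fun S ε hε => ?_
  suffices hsuff : ∃ y ∈ NonUnitalAlgHom.range κ, ‖y‖ ≤ 1 + ε ∧
      ∀ b ∈ S.image κ, ‖y * b - b‖ ≤ ε ∧ ‖b * y - b‖ ≤ ε by
    obtain ⟨_, ⟨y, rfl⟩, hy1, hyS⟩ := hsuff
    refine ⟨y, (hκ y).ge.trans hy1, fun b hb => ?_⟩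
    have := hyS (κ b) (Finset.mem_image_of_mem _ hb)
    have h1 : κ y * κ b - κ b = κ (y * b - b) := by rw [map_sub, map_mul]
    have h2 : κ b * κ y - κ b = κ (b * y - b) := by rw [map_sub, map_mul]
    change ‖κ y * κ b - κ b‖ ≤ ε ∧ ‖κ b * κ y - κ b‖ ≤ ε at this
    rwa [h1, h2, hκ, hκ] at this
  refine exists_nearUnit_of_forall_exists_mod (I := Set.range ψ) ?_ ?_ ?_ ?_ ?_ hε
  · rintro _ ⟨a, rfl⟩
    exact ⟨φ a, rfl⟩
  · rintro _ ⟨b, rfl⟩ _ ⟨a, rfl⟩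
    obtain ⟨a₁, h1⟩ := (hex (b * φ a)).1 (by rw [map_mul, hk, mul_zero])
    obtain ⟨a₂, h2⟩ := (hex (φ a * b)).1 (by rw [map_mul, hk, zero_mul])
    exact ⟨⟨a₁, (congrArg κ h1).trans (map_mul κ b (φ a))⟩,
      ⟨a₂, (congrArg κ h2).trans (map_mul κ (φ a) b)⟩⟩
  · intro δ hδ
    obtain ⟨l, hl, h1⟩ := hA δ hδ
    have := hl.neBot
    refine ⟨l.map ψ, inferInstance, eventually_map.2 ?_, ?_, ?_⟩
    · filter_upwards [h1] with e he
      exact ⟨⟨e, rfl⟩, (hψ e).le.trans he.1,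
        (he.2.map (φ := ψ) fun v => (hψ v).le).norm_one_sub_le hδ⟩
    · rintro _ ⟨a, rfl⟩
      rw [tendsto_map'_iff]
      exact ((hψc.tendsto a).comp (hl.tendsto_mul_right a)).congr fun e => map_mul ψ e a
    · rintro _ ⟨a, rfl⟩
      rw [tendsto_map'_iff]
      exact ((hψc.tendsto a).comp (hl.tendsto_mul_left a)).congr fun e => map_mul ψ a e
  · intro b hb
    obtain ⟨b, -, rfl⟩ := Finset.mem_image.1 hb
    exact ⟨b, rfl⟩
  · intro η hη
    obtain ⟨m, hm, hm1⟩ := hC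
    have := hm.neBot
    -- Only the open unit ball is known to lift, so the cai of `C` is shrunk by `1 - s` with `s → 0`
    -- from above.
    have hs : Tendsto (fun p : ℝ × C => (((1 - p.1 : ℝ)) : ℂ)) (𝓝[>] 0 ×ˢ m) (𝓝 1) := by
      have h1 : Continuous fun s : ℝ => ((1 - s : ℝ) : ℂ) := by fun_prop
      have h2 := (h1.tendsto 0).mono_left (nhdsWithin_le_nhds (s := Set.Ioi 0))
      simp only [sub_zero, Complex.ofReal_one] at h2
      exact h2.comp tendsto_fst
    have hL : ∀ b, ∀ᶠ p : ℝ × C in 𝓝[>] 0 ×ˢ m,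
        ‖((((1 - p.1 : ℝ)) : ℂ) • p.2) * q b - q b‖ < η := fun b => by
      have h1 := hs.smul ((hm.tendsto_mul_right (q b)).comp tendsto_snd)
      rw [one_smul] at h1
      have h2 := (tendsto_iff_norm_sub_tendsto_zero.1 h1).eventually_lt_const hη
      simpa only [Function.comp_def, smul_mul_assoc] using h2
    have hR : ∀ b, ∀ᶠ p : ℝ × C in 𝓝[>] 0 ×ˢ m,
        ‖q b * ((((1 - p.1 : ℝ)) : ℂ) • p.2) - q b‖ < η := fun b => by
      have h1 := hs.smul ((hm.tendsto_mul_left (q b)).comp tendsto_snd)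
      rw [one_smul] at h1
      have h2 := (tendsto_iff_norm_sub_tendsto_zero.1 h1).eventually_lt_const hη
      simpa only [Function.comp_def, mul_smul_comm] using h2
    have hsmall : ∀ᶠ p : ℝ × C in 𝓝[>] 0 ×ˢ m, ‖(((1 - p.1 : ℝ)) : ℂ) • p.2‖ < 1 := by
      have h1 : ∀ᶠ s : ℝ in 𝓝[>] 0, s ∈ Set.Ioo (0 : ℝ) 1 := Ioo_mem_nhdsGT zero_lt_one
      filter_upwards [h1.prod_inl m, hm1.prod_inr (𝓝[>] (0 : ℝ))] with p hp1 hp2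
      rw [norm_smul, Complex.norm_of_nonneg (by linarith [hp1.2])]
      exact (mul_le_of_le_one_right (by linarith [hp1.2]) hp2).trans_lt (by linarith [hp1.1])
    obtain ⟨p, hp1, hp2⟩ := (hsmall.and ((eventually_all_finset S).2 fun b _ =>
      (hL b).and (hR b))).exists
    set c := (((1 - p.1 : ℝ)) : ℂ) • p.2
    obtain ⟨x, hx1, hxc⟩ := hq c hp1
    refine ⟨κ x, ⟨x, rfl⟩, (hκ x).le.trans hx1.le, fun b hb => ?_⟩
    obtain ⟨b, hbS, rfl⟩ := Finset.mem_image.1 hb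
    -- Lifting `q z` to an element of norm below `η` and subtracting it from `z` leaves an element
    -- of the kernel close to `z`.
    have key : ∀ z : B, ‖q z‖ < η → ∃ a ∈ Set.range ψ, ‖κ z - a‖ ≤ η := fun z hz => by
      obtain ⟨z', hz', hqz⟩ := exists_lift_lt hq hz
      obtain ⟨a, ha⟩ := (hex (z - z')).1 (by rw [map_sub, hqz, sub_self])
      refine ⟨_, ⟨a, rfl⟩, ?_⟩
      change ‖κ z - κ (φ a)‖ ≤ η
      rw [ha, ← map_sub, sub_sub_cancel, hκ]
      exact hz'.le
    have k1 := key (x * b - b) (by rw [map_sub, map_mul, hxc]; exact (hp2 b hbS).1)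
    have k2 := key (b * x - b) (by rw [map_sub, map_mul, hxc]; exact (hp2 b hbS).2)
    rw [map_sub, map_mul] at k1 k2
    exact ⟨k1, k2⟩

end ExtensionApproxUnital

/-! ### The middle term of a subextension -/

section Subextension

variable {D E F : Type*}
  [NonUnitalNormedRing D] [NormedSpace ℂ D] [MatrixNorms D] [LawfulMatrixNorms D]
  [NonUnitalNormedRing E] [NormedSpace ℂ E] [MatrixNorms E] [LawfulMatrixNorms E]
  [NonUnitalNormedRing F] [NormedSpace ℂ F] [MatrixNorms F] [LawfulMatrixNorms F]
  {𝒦 : OpAlgCategory} {α : D →ₙₐ[ℂ] E} {β : E →ₙₐ[ℂ] F}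
  {A : NonUnitalSubalgebra ℂ D}

/-- Taking one of the two elements of `A` to be 0 separates the left and right conditions. -/
theorem mem_idealizer {b : E} : b ∈ idealizer α A ↔
    ∀ a ∈ A, b * α a ∈ α '' (A : Set D) ∧ α a * b ∈ α '' (A : Set D) := by
  constructor
  · intro h a ha
    have h1 := h a ha 0 A.zero_mem
    have h2 := h 0 A.zero_mem a ha
    simp only [map_zero, zero_mul, mul_zero, add_zero, zero_add] at h1 h2
    exact ⟨h1, h2⟩
  · intro h a ha a' ha'
    obtain ⟨x, hx, hx'⟩ := (h a ha).1
    obtain ⟨y, hy, hy'⟩ := (h a' ha').2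
    exact ⟨x + y, A.add_mem hx hy, by rw [map_add, hx', hy']⟩

theorem map_mem_idealizer {a : D} (ha : a ∈ A) : α a ∈ idealizer α A :=
  mem_idealizer.2 fun x hx => ⟨⟨a * x, A.mul_mem ha hx, map_mul α a x⟩,
    ⟨x * a, A.mul_mem hx ha, map_mul α x a⟩⟩

variable [IsScalarTower ℂ E E] [SMulCommClass ℂ E E]

variable (α A) in
/-- The idealizer as a subalgebra. -/
def idealizerSubalgebra : NonUnitalSubalgebra ℂ E where
  carrier := idealizer α A
  zero_mem' := mem_idealizer.2 fun a _ => by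
    rw [zero_mul, mul_zero]
    exact ⟨⟨0, A.zero_mem, map_zero α⟩, ⟨0, A.zero_mem, map_zero α⟩⟩
  add_mem' {b b'} hb hb' := mem_idealizer.2 fun a ha => by
    obtain ⟨⟨x, hx, hx'⟩, y, hy, hy'⟩ := mem_idealizer.1 hb a ha
    obtain ⟨⟨x₁, hx₁, hx₁'⟩, y₁, hy₁, hy₁'⟩ := mem_idealizer.1 hb' a ha
    rw [add_mul, mul_add, ← hx', ← hx₁', ← hy', ← hy₁', ← map_add, ← map_add]
    exact ⟨⟨_, A.add_mem hx hx₁, rfl⟩, ⟨_, A.add_mem hy hy₁, rfl⟩⟩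
  mul_mem' {b b'} hb hb' := mem_idealizer.2 fun a ha => by
    obtain ⟨x, hx, hx'⟩ := (mem_idealizer.1 hb' a ha).1
    obtain ⟨y, hy, hy'⟩ := (mem_idealizer.1 hb a ha).2
    rw [mul_assoc, ← mul_assoc (α a), ← hx', ← hy']
    exact ⟨(mem_idealizer.1 hb x hx).1, (mem_idealizer.1 hb' y hy).2⟩
  smul_mem' c b hb := mem_idealizer.2 fun a ha => by
    obtain ⟨⟨x, hx, hx'⟩, y, hy, hy'⟩ := mem_idealizer.1 hb a ha
    rw [smul_mul_assoc, mul_smul_comm, ← hx', ← hy', ← map_smul, ← map_smul]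
    exact ⟨⟨_, SMulMemClass.smul_mem c hx, rfl⟩, ⟨_, SMulMemClass.smul_mem c hy, rfl⟩⟩

variable (α β A) in
/-- The subalgebra `{b ∈ β⁻¹(C) : bA + Ab ⊆ A}`. -/
def middleTerm (C : NonUnitalSubalgebra ℂ F) : NonUnitalSubalgebra ℂ E :=
  C.comap β ⊓ idealizerSubalgebra α A

namespace IsExtension

theorem isometry (h : IsExtension 𝒦 α β) : Isometry α :=
  AddMonoidHomClass.isometry_of_norm α h.norm_map

theorem map_map_eq_zero (h : IsExtension 𝒦 α β) (d : D) : β (α d) = 0 :=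
  (h.exact (α d)).2 ⟨d, rfl⟩

theorem norm_map_lt_one (h : IsExtension 𝒦 α β) {b : E} (hb : ‖b‖ < 1) : ‖β b‖ < 1 := by
  have : (Matrix.of fun _ _ : Fin 1 => β b) ∈
      {Y : Matrix (Fin 1) (Fin 1) F | MatrixNorms.matNorm Y < 1} := by
    rw [← h.isCompleteQuotientMap 1]
    refine ⟨Matrix.of fun _ _ => b, ?_, rfl⟩
    change MatrixNorms.matNorm _ < 1
    rwa [LawfulMatrixNorms.matNorm_one]
  change MatrixNorms.matNorm _ < 1 at this
  rwa [LawfulMatrixNorms.matNorm_one] at this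

theorem norm_map_right_le (h : IsExtension 𝒦 α β) (b : E) : ‖β b‖ ≤ ‖b‖ := by
  refine le_of_forall_gt_imp_ge_of_dense fun r hr => ?_
  have hr0 : 0 < r := (norm_nonneg _).trans_lt hr
  have hrn : ‖(r : ℂ)⁻¹‖ = r⁻¹ := by rw [norm_inv, Complex.norm_of_nonneg hr0.le]
  have := h.norm_map_lt_one (b := (r : ℂ)⁻¹ • b) (by
    rwa [norm_smul, hrn, inv_mul_lt_iff₀ hr0, mul_one])
  rw [map_smul, norm_smul, hrn, inv_mul_lt_iff₀ hr0, mul_one] at this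
  exact this.le

theorem continuous_right (h : IsExtension 𝒦 α β) : Continuous β :=
  AddMonoidHomClass.continuous_of_bound β 1 fun b => by
    rw [one_mul]; exact h.norm_map_right_le b

/-- As `α` is isometric, `α(A)` is complete, hence closed, and the idealizer is an intersection of
its preimages under continuous maps. -/
theorem isClosed_idealizer (h : IsExtension 𝒦 α β) (hA : CompleteSpace A) :
    IsClosed (idealizer α A) := by
  have hcl : IsClosed (α '' (A : Set D)) :=
    (h.isometry.isUniformInducing.isComplete_iff.2
      (completeSpace_coe_iff_isComplete.1 hA)).isClosed
  have : idealizer α A = ⋂ a ∈ A, ⋂ a' ∈ A,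
      (fun b => b * α a + α a' * b) ⁻¹' (α '' (A : Set D)) := by
    ext b
    simp [idealizer]
  rw [this]
  refine isClosed_biInter fun a _ => isClosed_biInter fun a' _ => hcl.preimage ?_
  fun_prop

theorem isClosed_middleTerm (h : IsExtension 𝒦 α β) (hA : CompleteSpace A)
    {C : NonUnitalSubalgebra ℂ F} (hC : IsClosed (C : Set F)) :
    IsClosed (middleTerm α β A C : Set E) :=
  (hC.preimage h.continuous_right).inter (h.isClosed_idealizer hA)

theorem map_left_mem_middleTerm (h : IsExtension 𝒦 α β) (C : NonUnitalSubalgebra ℂ F) {a : D}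
    (ha : a ∈ A) : α a ∈ middleTerm α β A C :=
  ⟨by
    change β (α a) ∈ C
    rw [h.map_map_eq_zero]
    exact C.zero_mem, map_mem_idealizer ha⟩

variable [IsScalarTower ℂ D D] [SMulCommClass ℂ D D]

/-- This makes the kernel of `β` on the idealizer exactly `α(A)`; it is the source of both exactness
and uniqueness of the middle term. -/
theorem mem_left_of_map_mem_idealizer (h : IsExtension 𝒦 α β) (hcai : ContainsCai A)
    (hA : IsClosed (A : Set D)) {d : D} (hd : α d ∈ idealizer α A) : d ∈ A := by
  refine hcai.mem_of_forall_mul_mem hA fun a ha => ?_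
  obtain ⟨x, hx, hx'⟩ := (mem_idealizer.1 hd a ha).1
  rw [← map_mul] at hx'
  rwa [← h.injective hx']

theorem exact_restrict (h : IsExtension 𝒦 α β) (hcai : ContainsCai A) (hA : IsClosed (A : Set D))
    (C : NonUnitalSubalgebra ℂ F) :
    Function.Exact (restrictHom α A (middleTerm α β A C) fun _ => h.map_left_mem_middleTerm C)
      (restrictHom β (middleTerm α β A C) C fun _ hb => hb.1) := by
  intro b
  constructor
  · intro hb
    obtain ⟨d, hd⟩ := (h.exact (b : E)).1 (congrArg Subtype.val hb)
    have hdA : d ∈ A := h.mem_left_of_map_mem_idealizer hcai hA (by rw [hd]; exact b.2.2)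
    exact ⟨⟨d, hdA⟩, Subtype.ext hd⟩
  · rintro ⟨a, rfl⟩
    exact Subtype.ext (h.map_map_eq_zero (a : D))

variable {H : Type*} [NormedAddCommGroup H] [InnerProductSpace ℂ H] [CompleteSpace H]
  {ι : E →ₙₐ[ℂ] (H →L[ℂ] H)}

theorem isCompleteQuotientMap_restrict (h : IsExtension 𝒦 α β) (hι : IsCompleteIsometry ι)
    (hcai : ContainsCai A) (hA : CompleteSpace A) {C : NonUnitalSubalgebra ℂ F}
    (hC : (C : Set F) ⊆ β '' idealizer α A) :
    IsCompleteQuotientMap (restrictHom β (middleTerm α β A C) C fun _ hb => hb.1) := by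
  intro n
  ext Y
  constructor
  · rintro ⟨X, hX, rfl⟩
    have : (X.map (fun b : middleTerm α β A C => (b : E))).map β ∈
        {Y : Matrix (Fin n) (Fin n) F | MatrixNorms.matNorm Y < 1} := by
      rw [← h.isCompleteQuotientMap n]
      exact ⟨_, hX, rfl⟩
    exact this
  · intro hY
    have hY' : Y.map (fun c : C => (c : F)) ∈
        {Y : Matrix (Fin n) (Fin n) F | MatrixNorms.matNorm Y < 1} := hY
    rw [← h.isCompleteQuotientMap n] at hY'
    obtain ⟨X₀, hX₀, hXY⟩ := hY'
    replace hX₀ : MatrixNorms.matNorm X₀ < 1 := hX₀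
    -- There are two lifts of `Y`: `X₀` has norm below 1, `x₁` has entries in the idealizer. They
    -- differ by a matrix over `α(D)`, and multiplying `x₁` by `1 - α f` joins the two virtues.
    choose x₁ hx₁ hxY using fun i j => hC (Y i j).2
    have hβ₀ : ∀ i j, β (X₀ i j) = Y i j := fun i j => congrFun (congrFun hXY i) j
    choose d hd using fun i j => (h.exact (x₁ i j - X₀ i j)).1 (by
      rw [map_sub, hxY, hβ₀, sub_self])
    obtain ⟨δ, hδ, hδ1⟩ : ∃ δ > 0, (1 + δ) * MatrixNorms.matNorm X₀ + δ < 1 := by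
      have h1 : Continuous fun δ : ℝ => (1 + δ) * MatrixNorms.matNorm X₀ + δ := by fun_prop
      have h2 := (h1.tendsto 0).mono_left (nhdsWithin_le_nhds (s := Set.Ioi 0))
      simp only [add_zero, one_mul] at h2
      obtain ⟨δ, h3, h4⟩ := ((h2.eventually_lt_const hX₀).and self_mem_nhdsWithin).exists
      exact ⟨δ, h4, h3⟩
    obtain ⟨l, hl, h1⟩ := hcai.exists_regularized hA hδ
    have : l.NeBot := map_neBot_iff _ |>.1 hl.neBot
    let X₁ : Matrix (Fin n) (Fin n) E := Matrix.of x₁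
    let G : Matrix (Fin n) (Fin n) E := Matrix.of fun i j => α (d i j)
    have hG : X₁ = X₀ + G := by
      ext i j
      simp [X₁, G, hd]
    have hlim : Tendsto (fun f : A => MatrixNorms.matNorm
        (G - G * Matrix.diagonal fun _ => α f)) l (𝓝 0) := by
      refine hι.tendsto_matNorm_zero fun i j => ?_
      have h3 : Tendsto (fun f : A => d i j - d i j * (f : D)) l (𝓝 (d i j - d i j)) :=
        (tendsto_map'_iff.1 (hl.tendsto_mul_left (d i j))).const_sub _
      have h4 := (h.isometry.continuous.tendsto _).comp h3
      rw [sub_self, map_zero] at h4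
      simpa [G, Matrix.mul_diagonal, Function.comp_def] using h4
    obtain ⟨f, ⟨-, hf⟩, hfG⟩ := (h1.and (hlim.eventually_le_const hδ)).exists
    have hfE : IsRegularized δ (α f) :=
      (hf.map (φ := α.comp (NonUnitalSubalgebraClass.subtype A)) fun v => (h.norm_map (v : D)).le)
    have hβ : ∀ i j, β (x₁ i j - x₁ i j * α f) = Y i j := fun i j => by
      rw [map_sub, map_mul, h.map_map_eq_zero, mul_zero, sub_zero, hxY]
    have hmem : ∀ i j, x₁ i j - x₁ i j * α f ∈ middleTerm α β A C := fun i j => by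
      refine ⟨?_, (idealizerSubalgebra α A).sub_mem (hx₁ i j)
        ((idealizerSubalgebra α A).mul_mem (hx₁ i j) (map_mem_idealizer f.2))⟩
      change β _ ∈ C
      rw [hβ]
      exact (Y i j).2
    refine ⟨Matrix.of fun i j => ⟨_, hmem i j⟩, ?_, Matrix.ext fun i j => Subtype.ext (hβ i j)⟩
    have h5 : (Matrix.of fun i j => x₁ i j - x₁ i j * α f) =
        (X₀ - X₀ * Matrix.diagonal fun _ => α f) + (G - G * Matrix.diagonal fun _ => α f) := by
      have : (Matrix.of fun i j => x₁ i j - x₁ i j * α f) =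
          X₁ - X₁ * Matrix.diagonal fun _ => α (f : D) := by
        ext i j
        simp [X₁, Matrix.mul_diagonal]
      rw [this, hG, add_mul]
      abel
    change MatrixNorms.matNorm (Matrix.of fun i j => x₁ i j - x₁ i j * α f) < 1
    rw [h5]
    exact (hι.matNorm_add_le _ _).trans_lt ((add_le_add
      (hfE.matNorm_sub_right_le hι hδ X₀) hfG).trans_lt hδ1)

theorem approxUnital_middleTerm (h : IsExtension 𝒦 α β) (hι : IsCompleteIsometry ι)
    [IsScalarTower ℂ F F] [SMulCommClass ℂ F F]
    (hcai : ContainsCai A) (hA : IsClosed (A : Set D)) (hAc : CompleteSpace A)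
    {C : NonUnitalSubalgebra ℂ F} (hC : (C : Set F) ⊆ β '' idealizer α A) (hCu : ApproxUnital C) :
    ApproxUnital (middleTerm α β A C) := by
  refine approxUnital_of_exact (κ := ι.comp (NonUnitalSubalgebraClass.subtype _))
    (φ := restrictHom α A (middleTerm α β A C) fun _ => h.map_left_mem_middleTerm C)
    (q := restrictHom β (middleTerm α β A C) C fun _ hb => hb.1)
    (fun a => h.norm_map (a : D)) (fun b => hι.norm_map (b : E)) (h.exact_restrict hcai hA C)
    (fun c hc => ?_) hCu fun δ hδ => ?_
  · have hq := h.isCompleteQuotientMap_restrict hι hcai hAc hC 1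
    have : (Matrix.of fun _ _ : Fin 1 => c) ∈
        {Y : Matrix (Fin 1) (Fin 1) C | MatrixNorms.matNorm Y < 1} := by
      change MatrixNorms.matNorm _ < 1
      rwa [LawfulMatrixNorms.matNorm_one]
    rw [← hq] at this
    obtain ⟨X, hX, hXc⟩ := this
    refine ⟨X 0 0, ?_, congrFun (congrFun hXc 0) 0⟩
    have hX1 : X = Matrix.of fun _ _ => X 0 0 := by
      ext i j
      rw [Subsingleton.elim i 0, Subsingleton.elim j 0]
      rfl
    replace hX : MatrixNorms.matNorm X < 1 := hX
    rwa [hX1, LawfulMatrixNorms.matNorm_one] at hX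
  · obtain ⟨l, hl, h1⟩ := hcai.exists_regularized hAc hδ
    refine ⟨l, { tendsto_mul_left := fun m => ?_, tendsto_mul_right := fun m => ?_, neBot := ?_ },
      h1⟩
    · exact tendsto_subtype_rng.2 (tendsto_map'_iff.1 (hl.tendsto_mul_left (m : D)))
    · exact tendsto_subtype_rng.2 (tendsto_map'_iff.1 (hl.tendsto_mul_right (m : D)))
    · exact map_neBot_iff _ |>.1 hl.neBot

theorem isSubextension_middleTerm (h : IsExtension 𝒦 α β) (hι : IsCompleteIsometry ι)
    [IsScalarTower ℂ F F] [SMulCommClass ℂ F F] (hcai : ContainsCai A)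
    (hA : IsClosed (A : Set D)) (hAc : CompleteSpace A) {C : NonUnitalSubalgebra ℂ F}
    (hC : IsNontrivialSubobject 𝒦 C) (hCG : (C : Set F) ⊆ β '' idealizer α A) :
    IsSubextension 𝒦 α β A (middleTerm α β A C) C where
  isClosed_left := hA
  isClosed_middle := h.isClosed_middleTerm hAc hC.isClosed
  isClosed_right := hC.isClosed
  map_left _ := h.map_left_mem_middleTerm C
  map_middle _ hb := hb.1
  isExtension :=
    { nontrivial_left := by
        by_contra hn
        rw [not_nontrivial_iff_subsingleton] at hn
        obtain ⟨x, y, hxy⟩ := h.nontrivial_left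
        -- If `A` were zero its cai would be zero, forcing `D = 0`.
        have hzero : ∀ d : D, d ∈ A := fun d => hcai.mem_of_forall_mul_mem hA fun a ha => by
          have : a = 0 := congrArg Subtype.val (Subsingleton.elim (⟨a, ha⟩ : A) 0)
          rw [this, mul_zero]
          exact A.zero_mem
        exact hxy (congrArg Subtype.val
          (Subsingleton.elim (⟨x, hzero x⟩ : A) ⟨y, hzero y⟩))
      nontrivial_right := hC.nontrivial
      approxUnital := hcai.approxUnital
      isObject_middle := by
        -- Only in `AUOA` does the middle term need a cai, and then `C` has one to glue with that of
        -- `A`.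
        cases 𝒦 with
        | OA => trivial
        | AUOA => exact h.approxUnital_middleTerm hι hcai hA hAc hCG hC.isObject
      isObject_right := hC.isObject
      isCompleteIsometry := fun n X => h.isCompleteIsometry n (X.map fun a : A => (a : D))
      exact := h.exact_restrict hcai hA C
      isCompleteQuotientMap := h.isCompleteQuotientMap_restrict hι hcai hAc hCG }

end IsExtension

/-! ### Uniqueness of the middle term and comparison of Busby invariants -/

namespace IsSubextension

variable {B : NonUnitalSubalgebra ℂ E} {C : NonUnitalSubalgebra ℂ F}

/-- Products of `b` with `α(A)` stay in `B` and are killed by `β`, so exactness of the subextension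
returns them to `α(A)`. -/
theorem mem_idealizer_of_mem (hs : IsSubextension 𝒦 α β A B C) {b : E} (hb : b ∈ B) :
    b ∈ idealizer α A := by
  have hk : ∀ a ∈ A, β (α a) = 0 := fun a ha =>
    congrArg Subtype.val (hs.isExtension.map_map_eq_zero ⟨a, ha⟩)
  have key : ∀ x ∈ B, β x = 0 → x ∈ α '' (A : Set D) := fun x hx hx0 => by
    obtain ⟨a, ha⟩ := (hs.isExtension.exact ⟨x, hx⟩).1 (Subtype.ext hx0)
    exact ⟨a, a.2, congrArg Subtype.val ha⟩
  refine mem_idealizer.2 fun a ha => ⟨key _ (B.mul_mem hb (hs.map_left a ha)) ?_,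
    key _ (B.mul_mem (hs.map_left a ha) hb) ?_⟩
  · rw [map_mul, hk a ha, mul_zero]
  · rw [map_mul, hk a ha, zero_mul]

theorem exists_mem_map_eq (hs : IsSubextension 𝒦 α β A B C) {c : F} (hc : c ∈ C) :
    ∃ b ∈ B, β b = c := by
  obtain ⟨b, hb⟩ := hs.isExtension.surjective ⟨c, hc⟩
  exact ⟨b, b.2, congrArg Subtype.val hb⟩

/-- Given `b` in the larger algebra, some `b'` in `B` has the same image. The difference lies in
`α(D)` and in the idealizer, hence in `α(A) ⊆ B`. -/
theorem eq_middleTerm [IsScalarTower ℂ D D] [SMulCommClass ℂ D D]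
    (hs : IsSubextension 𝒦 α β A B C) (h : IsExtension 𝒦 α β) (hcai : ContainsCai A) :
    B = middleTerm α β A C := by
  ext b
  refine ⟨fun hb => ⟨hs.map_middle b hb, hs.mem_idealizer_of_mem hb⟩, fun hb => ?_⟩
  obtain ⟨b', hb', hbb⟩ := hs.exists_mem_map_eq hb.1
  obtain ⟨d, hd⟩ := (h.exact (b - b')).1 (by rw [map_sub, hbb]; exact sub_self _)
  have hdA : d ∈ A := h.mem_left_of_map_mem_idealizer hcai hs.isClosed_left (by
    rw [hd]
    exact (idealizerSubalgebra α A).sub_mem hb.2 (hs.mem_idealizer_of_mem hb'))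
  have := B.add_mem (hs.map_left d hdA) hb'
  rwa [hd, sub_add_cancel] at this

theorem isNontrivialSubobject (hs : IsSubextension 𝒦 α β A B C) : IsNontrivialSubobject 𝒦 C :=
  ⟨hs.isClosed_right, hs.isExtension.nontrivial_right, hs.isExtension.isObject_right⟩

theorem subset_image_idealizer (hs : IsSubextension 𝒦 α β A B C) :
    (C : Set F) ⊆ β '' idealizer α A := fun _ hc => by
  obtain ⟨b, hb, rfl⟩ := hs.exists_mem_map_eq hc
  exact ⟨b, hs.mem_idealizer_of_mem hb, rfl⟩

/-- Any lift of `c` computes either invariant, so one in `B` serves for both. Its multiplier of `D`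
restricts to its multiplier of `A`, and a multiplier of `D` is determined on `A`. -/
theorem coronaInclusion_busby [IsScalarTower ℂ D D] [SMulCommClass ℂ D D]
    (hs : IsSubextension 𝒦 α β A B C) (h : IsExtension 𝒦 α β) (hcai : ContainsCai A)
    (hD : CompleteSpace D) (c : C) :
    coronaInclusion hD hcai h.approxUnital (hs.isExtension.busby c) = h.busby (c : F) := by
  obtain ⟨b, rfl⟩ := hs.isExtension.surjective c
  change _ = h.busby (β (b : E))
  rw [h.busby_apply, hs.isExtension.busby_apply]
  refine (coronaInclusion_mk hD hcai h.approxUnital _).trans (congrArg _ ?_)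
  refine multiplier_ext hcai fun a => ?_
  rw [multiplierExtension_fst, multiplierExtension_snd]
  constructor
  · refine h.injective (Eq.trans ?_ (h.toMultiplier_fst (b : E) (a : D)).symm)
    exact congrArg Subtype.val (hs.isExtension.toMultiplier_fst b a)
  · refine h.injective (Eq.trans ?_ (h.toMultiplier_snd (b : E) (a : D)).symm)
    exact congrArg Subtype.val (hs.isExtension.toMultiplier_snd b a)

theorem preimage_busby [IsScalarTower ℂ D D] [SMulCommClass ℂ D D]
    (hs : IsSubextension 𝒦 α β A B C) (h : IsExtension 𝒦 α β) (hcai : ContainsCai A)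
    (hD : CompleteSpace D) (c : C) :
    coronaInclusion hD hcai h.approxUnital ⁻¹' {h.busby (c : F)} = {hs.isExtension.busby c} := by
  ext y
  rw [Set.mem_preimage, Set.mem_singleton_iff, Set.mem_singleton_iff,
    ← hs.coronaInclusion_busby h hcai hD c]
  exact (coronaInclusion_injective hD hcai h.approxUnital hs.isClosed_left).eq_iff

end IsSubextension

theorem IsExtension.bijOn_isSubextension [IsScalarTower ℂ D D] [SMulCommClass ℂ D D]
    [IsScalarTower ℂ F F] [SMulCommClass ℂ F F] {H : Type*} [NormedAddCommGroup H]
    [InnerProductSpace ℂ H] [CompleteSpace H] {ι : E →ₙₐ[ℂ] (H →L[ℂ] H)}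
    (h : IsExtension 𝒦 α β) (hι : IsCompleteIsometry ι) (hcai : ContainsCai A)
    (hA : IsClosed (A : Set D)) (hAc : CompleteSpace A) :
    Set.BijOn (fun p : NonUnitalSubalgebra ℂ E × NonUnitalSubalgebra ℂ F => p.2)
      {p | IsSubextension 𝒦 α β A p.1 p.2}
      {C | IsNontrivialSubobject 𝒦 C ∧ (C : Set F) ⊆ β '' idealizer α A} := by
  refine ⟨fun p hp => ⟨hp.isNontrivialSubobject, hp.subset_image_idealizer⟩, ?_, ?_⟩
  · rintro ⟨B, C⟩ hp ⟨B', C'⟩ hp' (rfl : C = C')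
    exact Prod.ext ((hp.eq_middleTerm h hcai).trans (hp'.eq_middleTerm h hcai).symm) rfl
  · rintro C ⟨hC, hCG⟩
    exact ⟨(middleTerm α β A C, C), h.isSubextension_middleTerm hι hcai hA hAc hC hCG, rfl⟩

end Subextension

end OpAlg

theorem theorem3p7 {H₁ H₂ H₃ : Type*}
    [NormedAddCommGroup H₁] [InnerProductSpace ℂ H₁] [CompleteSpace H₁]
    [NormedAddCommGroup H₂] [InnerProductSpace ℂ H₂] [CompleteSpace H₂]
    [NormedAddCommGroup H₃] [InnerProductSpace ℂ H₃] [CompleteSpace H₃]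
    (D : NonUnitalSubalgebra ℂ (H₁ →L[ℂ] H₁)) (hD : IsClosed (D : Set (H₁ →L[ℂ] H₁)))
    (E : NonUnitalSubalgebra ℂ (H₂ →L[ℂ] H₂)) (hE : IsClosed (E : Set (H₂ →L[ℂ] H₂)))
    (F : NonUnitalSubalgebra ℂ (H₃ →L[ℂ] H₃)) (hF : IsClosed (F : Set (H₃ →L[ℂ] H₃)))
    (𝒦 : OpAlg.OpAlgCategory) (α : D →ₙₐ[ℂ] E) (β : E →ₙₐ[ℂ] F)
    (h : OpAlg.IsExtension 𝒦 α β)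
    (A : NonUnitalSubalgebra ℂ D) (hA : IsClosed (A : Set D)) (hcai : OpAlg.ContainsCai A) :
    -- the subextensions `(A, B, C)` correspond bijectively, by taking the last term, to the
    -- nontrivial subobjects `C` of `𝒢 = β(idealizer)`
    Set.BijOn (fun p : NonUnitalSubalgebra ℂ E × NonUnitalSubalgebra ℂ F => p.2)
      {p | OpAlg.IsSubextension 𝒦 α β A p.1 p.2}
      {C | OpAlg.IsNontrivialSubobject 𝒦 C ∧ (C : Set F) ⊆ β '' OpAlg.idealizer α A} ∧
    -- the middle term
    (∀ B C, OpAlg.IsSubextension 𝒦 α β A B C →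
      (B : Set E) = {b | β b ∈ C ∧ b ∈ OpAlg.idealizer α A}) ∧
    -- the canonical morphism `j : 𝒬(A) → 𝒬(D)` is completely isometric and injective
    OpAlg.IsCompleteIsometry (OpAlg.coronaInclusion (OpAlg.completeSpace_of_isClosed hD) hcai h.approxUnital) ∧
    Function.Injective (OpAlg.coronaInclusion (OpAlg.completeSpace_of_isClosed hD) hcai h.approxUnital) ∧
    -- the Busby invariants: `j(τ'(c)) = τ(c)`, and `τ'(c)` is the only preimage of `τ(c)`
    (∀ B C, ∀ hs : OpAlg.IsSubextension 𝒦 α β A B C, ∀ c : C,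
      OpAlg.coronaInclusion (OpAlg.completeSpace_of_isClosed hD) hcai h.approxUnital (hs.isExtension.busby c) =
        h.busby (c : F) ∧
      OpAlg.coronaInclusion (OpAlg.completeSpace_of_isClosed hD) hcai h.approxUnital ⁻¹' {h.busby (c : F)} =
        {hs.isExtension.busby c}) := by
  have hDc : CompleteSpace D := OpAlg.completeSpace_of_isClosed hD
  have hAc : CompleteSpace A := OpAlg.completeSpace_of_isClosed hA
  have hιD := OpAlg.isCompleteIsometry_subtype D
  have hιE := OpAlg.isCompleteIsometry_subtype E
  exact ⟨h.bijOn_isSubextension hιE hcai hA hAc,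
    fun B C hs => congrArg (fun B' : NonUnitalSubalgebra ℂ E => (B' : Set E))
      (hs.eq_middleTerm h hcai),
    OpAlg.isCompleteIsometry_coronaInclusion hιD hDc hcai h.approxUnital hA,
    OpAlg.coronaInclusion_injective hDc hcai h.approxUnital hA,
    fun B C hs c => ⟨hs.coronaInclusion_busby h hcai hDc c, hs.preimage_busby h hcai hDc c⟩⟩
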